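/- All hypergraphs are finite; an $n$-vertex hypergraph has exactly $n$ vertices, and $[m]=\{1,\dots,m\}$. For a $k$-uniform hypergraph $H$ and $d\in[k-1]$, let $\delta_d(H)$ be the minimum, over all sets $D$ of $d$ vertices of $H$, of the number of edges of $H$ containing $D$. An embedding $\varphi:G\hookrightarrow H$ is an injective map $V(G)\to V(H)$ that maps every edge of $G$ to an edge of $H$; $H$ contains a copy of $G$ if there is such an embedding. A probability distribution $\mu$ on injections $\varphi:X\to Y$ is $q$-vertex-spread if $\mu(\{\varphi:\varphi(x_i)=y_i\text{ for all }i\in[s]\})\le q^s$ for all sequences of distinct $x_1,\dots,x_s\in X$ and of distinct $y_1,\dots,y_s\in Y$. For a $k$-uniform hypergraph $F$ with at least one vertex, let $\mathcal F_F$ be the family consisting, for each $i$, of the union of $i$ vertex-disjoint copies of $F$. Let $\delta_{F,d}$ be the smallest $\delta\in[0,1]$ such that for all $\alpha>0$ and all but finitely many $G\in\mathcal F_F$, with $n=|V(G)|$, every $n$-vertex $k$-uniform hypergraph $H$ with $\delta_d(H)\ge(\delta+\alpha)\binom{n-d}{k-d}$ contains a copy of $G$. Let $\delta^{\mathrm{vsd}}_{\mathcal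 F_F,d}$ be the smallest $\delta\in[0,1]$ such that for every $\alpha>0$ there is $C>0$ such that for all but finitely many $G\in\mathcal F_F$, with $n=|V(G)|$, for every $n$-vertex $k$-uniform hypergraph $H$ with $\delta_d(H)\ge(\delta+\alpha)\binom{n-d}{k-d}$ there is a $(C/n)$-vertex-spread distribution on embeddings $G\hookrightarrow H$. Theorem. Let $k,r\ge 1$ be integers. (1) For every $\alpha>0$ there exist $C=C(\alpha,k,r)>0$ and $n_0=n_0(\alpha,k,r)$ such that the following holds for all $d\in[k-1]$ and all $n\ge n_0$ with $r\mid n$. Let $F$ be a $k$-uniform $r$-vertex hypergraph, and let $G$ be the union of $n/r$ vertex-disjoint copies of $F$. If $H$ is an $n$-vertex $k$-uniform hypergraph with $\delta_d(H)\ge(\delta_{F,d}+\alpha)\binom{n-d}{k-d}$, then there is a $(C/n)$-vertex-spread distribution on embeddings $G\hookrightarrow H$. (2) Consequently, $\delta^{\mathrm{vsd}}_{\mathcal F_F,d}=\delta_{F,d}$ for every $k$-uniform $r$-vertex hypergraph $F$ and every $d\in[k-1]$. -/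

import Mathlib

open scoped ENNReal

namespace Hypergraph

universe u v

variable {V : Type u} {W : Type v}

/-- `H` has exactly `n` vertices (in particular, finitely many). -/
def HasOrder (H : Hypergraph V) (n : ℕ) : Prop := H.vertexSet.encard = n

/-- `H` is `k`-uniform: every edge has exactly `k` vertices. -/
def IsKUniform (H : Hypergraph V) (k : ℕ) : Prop := ∀ e ∈ H.edgeSet, e.encard = k

/-- The number of edges of `H` that contain the vertex set `D`. -/
noncomputable def setDegree (H : Hypergraph V) (D : Set V) : ℕ :=
  {e ∈ H.edgeSet | D ⊆ e}.ncard

/-- The minimum `d`-degree `δ_d(H)`: the minimum of `setDegree H D` over all sets `D` of `d`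
vertices of `H`. -/
noncomputable def minDegree (H : Hypergraph V) (d : ℕ) : ℕ :=
  sInf {m | ∃ D ⊆ H.vertexSet, D.encard = d ∧ H.setDegree D = m}

/-- The injection `φ : V(G) → V(H)` is an embedding of `G` into `H`: it maps every edge of `G` to an
edge of `H`. -/
def IsEmbedding (G : Hypergraph V) (H : Hypergraph W) (φ : G.vertexSet ↪ H.vertexSet) : Prop :=
  ∀ e ∈ G.edgeSet, {w : W | ∃ x : G.vertexSet, (x : V) ∈ e ∧ (φ x : W) = w} ∈ H.edgeSet

/-- `H` contains a copy of `G`. -/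
def ContainsCopy (G : Hypergraph V) (H : Hypergraph W) : Prop :=
  ∃ φ : G.vertexSet ↪ H.vertexSet, IsEmbedding G H φ

/-- A probability distribution `μ` on injections `X → Y` is `q`-vertex-spread if any `s` prescribed
values `φ (x i) = y i` (the `x i` distinct, the `y i` distinct) occur together with probability at
most `q ^ s`. -/
def IsVertexSpread {X : Type u} {Y : Type v} (q : ℝ) (μ : PMF (X ↪ Y)) : Prop :=
  ∀ (s : ℕ) (x : Fin s ↪ X) (y : Fin s ↪ Y),
    μ.toOuterMeasure {φ | ∀ i, φ (x i) = y i} ≤ ENNReal.ofReal q ^ s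

/-- There is a `q`-vertex-spread probability distribution on embeddings of `G` into `H`. -/
def HasVertexSpreadEmbedding (q : ℝ) (G : Hypergraph V) (H : Hypergraph W) : Prop :=
  ∃ μ : PMF (G.vertexSet ↪ H.vertexSet),
    (∀ φ ∈ μ.support, IsEmbedding G H φ) ∧ IsVertexSpread q μ

/-- `δ` is admissible in the definition of the Dirac threshold of the family `𝓕`: for all `α > 0`
and all but finitely many `G ∈ 𝓕`, if `n = |V(G)|`, then every `n`-vertex `k`-uniform `H` with
`δ_d(H) ≥ (δ + α) * binom (n - d) (k - d)` contains a copy of `G`. -/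
def DiracAdmissible (k d : ℕ) (𝓕 : Set (Hypergraph V)) (δ : ℝ) : Prop :=
  ∀ α : ℝ, 0 < α → {G ∈ 𝓕 | ¬ ∀ (n : ℕ), G.HasOrder n →
    ∀ (W : Type) (H : Hypergraph W), H.HasOrder n → H.IsKUniform k →
      (δ + α) * ((n - d).choose (k - d) : ℝ) ≤ (H.minDegree d : ℝ) →
      ContainsCopy G H}.Finite

/-- The minimum-degree (Dirac) threshold `δ_{𝓕,d}`, the smallest admissible `δ ∈ [0, 1]`. -/
noncomputable def diracThreshold (k d : ℕ) (𝓕 : Set (Hypergraph V)) : ℝ :=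
  sInf {δ : ℝ | δ ∈ Set.Icc (0 : ℝ) 1 ∧ DiracAdmissible k d 𝓕 δ}

/-- `δ` is admissible in the definition of the vertex-spread Dirac threshold of `𝓕`: for all `α > 0`
there is `C > 0` such that for all but finitely many `G ∈ 𝓕`, if `n = |V(G)|`, then for every
`n`-vertex `k`-uniform `H` with `δ_d(H) ≥ (δ + α) * binom (n - d) (k - d)` there is a
`(C / n)`-vertex-spread distribution on embeddings of `G` into `H`. -/
def VsdAdmissible (k d : ℕ) (𝓕 : Set (Hypergraph V)) (δ : ℝ) : Prop :=
  ∀ α : ℝ, 0 < α → ∃ C : ℝ, 0 < C ∧ {G ∈ 𝓕 | ¬ ∀ (n : ℕ), G.HasOrder n →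
    ∀ (W : Type) (H : Hypergraph W), H.HasOrder n → H.IsKUniform k →
      (δ + α) * ((n - d).choose (k - d) : ℝ) ≤ (H.minDegree d : ℝ) →
      HasVertexSpreadEmbedding (C / n) G H}.Finite

/-- The vertex-spread Dirac threshold of `𝓕`, the smallest admissible `δ ∈ [0, 1]`. -/
noncomputable def vsdThreshold (k d : ℕ) (𝓕 : Set (Hypergraph V)) : ℝ :=
  sInf {δ : ℝ | δ ∈ Set.Icc (0 : ℝ) 1 ∧ VsdAdmissible k d 𝓕 δ}

/-- The union of `m` vertex-disjoint copies of `F`, with vertex set `{0, …, m - 1} × V(F)`. -/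
def copies (F : Hypergraph V) (m : ℕ) : Hypergraph (ℕ × V) where
  vertexSet := {p | p.1 < m ∧ p.2 ∈ F.vertexSet}
  edgeSet := {e' | ∃ i < m, ∃ e ∈ F.edgeSet, e' = Prod.mk i '' e}
  subset_vertexSet_of_mem_edgeSet' := by
    rintro _ ⟨i, hi, e, he, rfl⟩ _ ⟨x, hx, rfl⟩
    exact ⟨hi, F.subset_vertexSet_of_mem_edgeSet' he hx⟩

/-- The family `𝓕_F` of all disjoint unions of copies of `F`. -/
def factorFamily (F : Hypergraph V) : Set (Hypergraph (ℕ × V)) := Set.range F.copies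

/-- The threshold `δ_{F,d}` for `F`-factors. -/
noncomputable def factorThreshold (k d : ℕ) (F : Hypergraph V) : ℝ :=
  diracThreshold k d F.factorFamily

/-! Both thresholds are well defined: for the families `𝓕_F` the infima above are attained. -/

theorem HasOrder.copies {F : Hypergraph V} {r : ℕ} (h : F.HasOrder r) (m : ℕ) :
    (F.copies m).HasOrder (m * r) := by
  have e : (F.copies m).vertexSet = Set.Iio m ×ˢ F.vertexSet := by
    ext p; simp [Hypergraph.copies]
  have h1 : (Set.Iio m : Set ℕ).encard = m := by
    rw [← Finset.coe_Iio, Set.encard_coe_eq_coe_finsetCard]; simp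
  unfold HasOrder at *
  rw [e, Set.encard_prod, h, h1]; push_cast; rfl

theorem minDegree_le_choose {H : Hypergraph V} {n k d : ℕ} (hn : H.HasOrder n)
    (hk : H.IsKUniform k) (hd : d ≤ n) : H.minDegree d ≤ (n - d).choose (k - d) := by
  classical
  have hfin : H.vertexSet.Finite := Set.finite_of_encard_eq_coe hn
  obtain ⟨D, hD, hDc⟩ := Set.exists_subset_encard_eq (s := H.vertexSet) (k := d)
    (by rw [hn]; exact_mod_cast hd)
  have hle : H.minDegree d ≤ H.setDegree D := Nat.sInf_le ⟨D, hD, hDc, rfl⟩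
  refine hle.trans ?_
  have hDf : D.Finite := hfin.subset hD
  have hRf : (H.vertexSet \ D).Finite := hfin.subset Set.sdiff_subset
  have hRc : hRf.toFinset.card = n - d := by
    rw [← Set.ncard_eq_toFinset_card _ hRf, Set.ncard_sdiff hD hDf]
    rw [Set.ncard_def, Set.ncard_def, hn, hDc]; simp
  rw [← hRc, ← Finset.card_powersetCard, ← Set.ncard_coe_finset]
  have hinj : Set.InjOn (fun e : Set V => e \ D) {e ∈ H.edgeSet | D ⊆ e} := by
    rintro e ⟨_, he⟩ f ⟨_, hf⟩ h
    rw [← Set.sdiff_union_of_subset he, ← Set.sdiff_union_of_subset hf]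
    exact congrArg (· ∪ D) h
  have hcoe : Function.Injective (fun s : Finset V => (s : Set V)) := Finset.coe_injective
  rw [setDegree, ← hinj.ncard_image,
    ← Set.ncard_image_of_injective _ hcoe]
  refine Set.ncard_le_ncard ?_ ((Finset.finite_toSet _).image _)
  rintro _ ⟨e, ⟨he, hDe⟩, rfl⟩
  have hev : e ⊆ H.vertexSet := H.subset_vertexSet_of_mem_edgeSet' he
  have hef : (e \ D).Finite := hfin.subset (Set.sdiff_subset.trans hev)
  refine ⟨hef.toFinset, ?_, by simp⟩
  rw [Finset.mem_coe, Finset.mem_powersetCard]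
  refine ⟨?_, ?_⟩
  · intro x hx
    simp only [Set.Finite.mem_toFinset, Set.mem_sdiff] at hx ⊢
    exact ⟨hev hx.1, hx.2⟩
  · rw [← Set.ncard_eq_toFinset_card _ hef, Set.ncard_sdiff hDe hDf,
      Set.ncard_def, Set.ncard_def, hk e he, hDc]; simp

/-- Members of `𝓕_F` for which the degree condition with `δ = 1` can hold are finite in number. -/
theorem finite_factorFamily_of_one {F : Hypergraph V} {r k d : ℕ} (hr : 1 ≤ r) (hF : F.HasOrder r)
    (hd : d ≤ k) {α : ℝ} (hα : 0 < α) (P : Hypergraph (ℕ × V) → ℕ → ∀ W : Type, Hypergraph W → Prop) :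
    {G ∈ F.factorFamily | ¬ ∀ (n : ℕ), G.HasOrder n →
      ∀ (W : Type) (H : Hypergraph W), H.HasOrder n → H.IsKUniform k →
        (1 + α) * ((n - d).choose (k - d) : ℝ) ≤ (H.minDegree d : ℝ) → P G n W H}.Finite := by
  refine ((Set.finite_Iio k).image F.copies).subset ?_
  rintro _ ⟨⟨m, rfl⟩, hm⟩
  refine ⟨m, ?_, rfl⟩
  by_contra hmk
  simp only [Set.mem_Iio, not_lt] at hmk
  apply hm
  intro n hn W H hH hU hdeg
  exfalso
  have hnm : n = m * r := by
    have h := hF.copies m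
    unfold HasOrder at h hn
    rw [hn] at h
    exact_mod_cast h
  have hkn : k ≤ n := by rw [hnm]; nlinarith
  have h1 : (H.minDegree d : ℝ) ≤ ((n - d).choose (k - d) : ℝ) := by
    exact_mod_cast minDegree_le_choose hH hU (hd.trans hkn)
  have h2 : (0 : ℝ) < ((n - d).choose (k - d) : ℝ) := by
    exact_mod_cast Nat.choose_pos (by omega)
  nlinarith

/-- `δ_{F,d}` is indeed the smallest admissible real number in `[0, 1]`. -/
theorem isLeast_factorThreshold {F : Hypergraph V} {r k d : ℕ} (hr : 1 ≤ r) (hF : F.HasOrder r)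
    (hd : d ≤ k) :
    IsLeast {δ : ℝ | δ ∈ Set.Icc (0 : ℝ) 1 ∧ DiracAdmissible k d F.factorFamily δ}
      (F.factorThreshold k d) := by
  set S := {δ : ℝ | δ ∈ Set.Icc (0 : ℝ) 1 ∧ DiracAdmissible k d F.factorFamily δ} with hS
  have h1 : (1 : ℝ) ∈ S := ⟨by simp, fun α hα =>
    finite_factorFamily_of_one hr hF hd hα fun G _ _ H => ContainsCopy G H⟩
  have hb : BddBelow S := ⟨0, fun δ h => h.1.1⟩
  refine ⟨⟨⟨le_csInf ⟨1, h1⟩ fun δ h => h.1.1, csInf_le hb h1⟩, ?_⟩, fun δ h => csInf_le hb h⟩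
  intro α hα
  obtain ⟨δ', hδ', hlt⟩ := exists_lt_of_csInf_lt ⟨1, h1⟩ (lt_add_of_pos_right (sInf S) (half_pos hα))
  refine (hδ'.2 (α / 2) (half_pos hα)).subset ?_
  rintro G ⟨hG, hn⟩
  refine ⟨hG, fun h => hn fun n hGn W H hH hU hdeg => h n hGn W H hH hU (le_trans ?_ hdeg)⟩
  have : δ' + α / 2 ≤ sInf S + α := by linarith
  exact mul_le_mul_of_nonneg_right this (Nat.cast_nonneg _)

/-- The vertex-spread Dirac threshold of `𝓕_F` is indeed the smallest admissible real number in
`[0, 1]`. -/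
theorem isLeast_vsdThreshold {F : Hypergraph V} {r k d : ℕ} (hr : 1 ≤ r) (hF : F.HasOrder r)
    (hd : d ≤ k) :
    IsLeast {δ : ℝ | δ ∈ Set.Icc (0 : ℝ) 1 ∧ VsdAdmissible k d F.factorFamily δ}
      (vsdThreshold k d F.factorFamily) := by
  set S := {δ : ℝ | δ ∈ Set.Icc (0 : ℝ) 1 ∧ VsdAdmissible k d F.factorFamily δ} with hS
  have h1 : (1 : ℝ) ∈ S := ⟨by simp, fun α hα => ⟨1, one_pos,
    finite_factorFamily_of_one hr hF hd hα fun G n _ H => HasVertexSpreadEmbedding (1 / n) G H⟩⟩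
  have hb : BddBelow S := ⟨0, fun δ h => h.1.1⟩
  refine ⟨⟨⟨le_csInf ⟨1, h1⟩ fun δ h => h.1.1, csInf_le hb h1⟩, ?_⟩, fun δ h => csInf_le hb h⟩
  intro α hα
  obtain ⟨δ', hδ', hlt⟩ := exists_lt_of_csInf_lt ⟨1, h1⟩ (lt_add_of_pos_right (sInf S) (half_pos hα))
  obtain ⟨C, hC, hfin⟩ := hδ'.2 (α / 2) (half_pos hα)
  refine ⟨C, hC, hfin.subset ?_⟩
  rintro G ⟨hG, hn⟩
  refine ⟨hG, fun h => hn fun n hGn W H hH hU hdeg => h n hGn W H hH hU (le_trans ?_ hdeg)⟩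
  have : δ' + α / 2 ≤ sInf S + α := by linarith
  exact mul_le_mul_of_nonneg_right this (Nat.cast_nonneg _)

end Hypergraph

/-! Group the copies of `F` into blocks of between `K` and `2 * K` copies, with `K` a large
constant. Take a random bijection from the vertices of `G` to those of `H`, and repair it inside
each block. The image `U` of a block is a random set of bounded size `m`. Sampling shows that, even
among the sets through a prescribed vertex, all but a fraction exponentially small in `m` induce a
subhypergraph with minimum `d`-degree at least `(δ + α / 2) * (m - d).choose (k - d)`. For such `U`
the definition of the threshold yields an `F`-factor of the subhypergraph induced on `U`
(`exists_inherits_minDegree`, `exists_forall_containsCopy_copies`).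

The number of blocks grows with `n` while the failure probability of one block is only a small
constant, so a union bound over blocks is useless. Instead the bijection is drawn uniformly from
those with no bad block. The lopsided local lemma shows that they exist and controls their
distribution (`exists_spread_bijections`). A bad event is "the bijection extends a given bad
injection of a block". Avoiding other such events does not make this one likelier if they share
neither arguments nor values with it. The same fact gives spread: after discarding the events that
touch one of `s` prescribed pairs, the prescription has conditional probability at most `1 /
n.descFactorial s`, and restoring the discarded events costs a factor 2 per pair.

The repair only permutes images within a block, so a prescribed value of the embedding pins down the
preimage under the bijection up to `M` choices, where `M` bounds the block size in vertices. With `n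
^ s ≤ 3 ^ s * n.descFactorial s`, the result is spread with constant `6 * M`
(`hasVertexSpreadEmbedding_of_blocks`). The constants are uniform in `F` and `d` because, up to
isomorphism, only finitely many pairs occur. The equality of thresholds follows, since a spread
distribution has nonempty support and so provides a copy. -/

namespace LocalLemma

/-! ### The lopsided local lemma, in counting form -/

open Finset

variable {Ω ι : Type*} [Fintype Ω]

open Classical in
/-- The outcomes that avoid all the events `B b`, `b ∈ S`. -/
noncomputable def avoid (B : ι → Set Ω) (S : Finset ι) : Finset Ω :=
  univ.filter fun ω => ∀ b ∈ S, ω ∉ B b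

open Classical in
/-- The outcomes in the event `A` that avoid all the events `B b`, `b ∈ S`. -/
noncomputable def inAvoid (A : Set Ω) (B : ι → Set Ω) (S : Finset ι) : Finset Ω :=
  univ.filter fun ω => ω ∈ A ∧ ∀ b ∈ S, ω ∉ B b

theorem avoid_anti (B : ι → Set Ω) {S T : Finset ι} (h : T ⊆ S) : avoid B S ⊆ avoid B T := by
  intro ω
  simp only [avoid, mem_filter, mem_univ, true_and]
  exact fun hω b hb => hω b (h hb)

theorem inAvoid_anti (A : Set Ω) (B : ι → Set Ω) {S T : Finset ι} (h : T ⊆ S) :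
    inAvoid A B S ⊆ inAvoid A B T := by
  intro ω
  simp only [inAvoid, mem_filter, mem_univ, true_and]
  exact fun hω => ⟨hω.1, fun b hb => hω.2 b (h hb)⟩

-- A union bound: among the outcomes avoiding `T`, each event of `R` occupies a fraction at most `2
-- * p b`, hence all of `R` together at most one half. At least half of the outcomes survive when
-- `R` is avoided too.
open Classical in
theorem card_avoid_le_two_mul (B : ι → Set Ω) (p : ι → ℝ) (T R S : Finset ι)
    (hS : S ⊆ T ∪ R)
    (hT : ∀ a ∈ R, ((inAvoid (B a) B T).card : ℝ) ≤ 2 * p a * (avoid B T).card)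
    (hR : ∑ b ∈ R, p b ≤ 1 / 4) :
    ((avoid B T).card : ℝ) ≤ 2 * (avoid B S).card := by
  have hsub : avoid B T ⊆ avoid B S ∪ R.biUnion fun b => inAvoid (B b) B T := by
    intro ω hω
    by_cases h : ∀ b ∈ R, ω ∉ B b
    · refine mem_union_left _ ?_
      simp only [avoid, mem_filter, mem_univ, true_and] at hω ⊢
      intro b hb
      rcases mem_union.1 (hS hb) with hb | hb
      exacts [hω b hb, h b hb]
    · push Not at h
      obtain ⟨b, hb, hωb⟩ := h
      refine mem_union_right _ (mem_biUnion.2 ⟨b, hb, ?_⟩)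
      simp only [avoid, inAvoid, mem_filter, mem_univ, true_and] at hω ⊢
      exact ⟨hωb, hω⟩
  have h1 : ((avoid B T).card : ℝ) ≤ (avoid B S).card + ∑ b ∈ R, ((inAvoid (B b) B T).card : ℝ) := by
    exact_mod_cast (card_le_card hsub).trans
      ((card_union_le _ _).trans (Nat.add_le_add_left card_biUnion_le _))
  have h2 : ∑ b ∈ R, ((inAvoid (B b) B T).card : ℝ) ≤ ∑ b ∈ R, 2 * p b * (avoid B T).card :=
    sum_le_sum hT
  rw [← sum_mul, ← mul_sum] at h2
  have h3 : (0 : ℝ) ≤ (avoid B T).card := Nat.cast_nonneg _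
  nlinarith

open Classical in
/-- The lopsided local lemma: conditioning on avoiding bad events at most doubles the probability
of a bad event. -/
theorem card_inAvoid_le (B : ι → Set Ω) (p : ι → ℝ) (hp : ∀ a, 0 ≤ p a) (bad : Finset ι)
    (N : ι → ι → Prop)
    (hlop : ∀ a ∈ bad, ∀ S ⊆ bad, (∀ b ∈ S, ¬ N a b) →
      ((inAvoid (B a) B S).card : ℝ) ≤ p a * (avoid B S).card)
    (hsum : ∀ a ∈ bad, ∑ b ∈ bad with N a b, p b ≤ 1 / 4) :
    ∀ S ⊆ bad, ∀ a ∈ bad, ((inAvoid (B a) B S).card : ℝ) ≤ 2 * p a * (avoid B S).card := by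
  intro S
  induction S using Finset.strongInduction with
  | H S ih =>
    intro hS a ha
    set R := S.filter (N a)
    set T := S.filter fun b => ¬ N a b
    have hTS : T ⊆ S := filter_subset _ _
    have hl := hlop a ha T (hTS.trans hS) fun b hb => (mem_filter.1 hb).2
    have hle : ((inAvoid (B a) B S).card : ℝ) ≤ (inAvoid (B a) B T).card := by
      exact_mod_cast card_le_card (inAvoid_anti _ B hTS)
    have hRs : ∑ b ∈ R, p b ≤ 1 / 4 :=
      (sum_le_sum_of_subset_of_nonneg (filter_subset_filter _ hS) fun b _ _ => hp b).trans
        (hsum a ha)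
    -- Restoring the neighbours `R` of `a` at most halves the count. If `R` is empty there is
    -- nothing to do; otherwise `T` is a proper subset of `S` and the induction hypothesis bounds
    -- the events of `R` conditioned on avoiding `T`.
    have key : ((avoid B T).card : ℝ) ≤ 2 * (avoid B S).card := by
      rcases hTS.eq_or_ssubset with h | h
      · rw [h]
        have : (0 : ℝ) ≤ (avoid B S).card := Nat.cast_nonneg _
        linarith
      · refine card_avoid_le_two_mul B p T R S ?_ (fun b hb => ih T h (hTS.trans hS) b
          (hS (mem_filter.1 hb).1)) hRs
        rw [union_comm, filter_union_filter_not_eq]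
    calc _ ≤ p a * (avoid B T).card := hle.trans hl
      _ ≤ p a * (2 * (avoid B S).card) := mul_le_mul_of_nonneg_left key (hp a)
      _ = _ := by ring

-- Adding one more event to avoid discards at most half of the outcomes, because its conditional
-- probability is at most `2 * p a ≤ 1 / 2`.
open Classical in
theorem avoid_nonempty [Nonempty Ω] (B : ι → Set Ω) (p : ι → ℝ) (bad : Finset ι)
    (hp : ∀ a ∈ bad, p a ≤ 1 / 4)
    (h : ∀ S ⊆ bad, ∀ a ∈ bad, ((inAvoid (B a) B S).card : ℝ) ≤ 2 * p a * (avoid B S).card) :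
    (avoid B bad).Nonempty := by
  suffices ∀ S ⊆ bad, (avoid B S).Nonempty from this bad subset_rfl
  intro S
  induction S using Finset.induction_on with
  | empty => intro _; simp [avoid]
  | insert a S _ ih =>
    intro hS
    have hS' : S ⊆ bad := (subset_insert a S).trans hS
    have ha : a ∈ bad := hS (mem_insert_self a S)
    have h1 := card_avoid_le_two_mul B p S {a} (insert a S) (by intro x; simp)
      (fun b hb => h S hS' b (by rwa [mem_singleton.1 hb])) (by simpa using hp a ha)
    have h2 : (0 : ℝ) < (avoid B S).card := by exact_mod_cast (ih hS').card_pos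
    have h3 : (0 : ℝ) < (avoid B (insert a S)).card := by linarith
    exact card_pos.1 (by exact_mod_cast h3)

/-- Avoiding bad events that split into `s` groups of small total weight. -/
theorem card_avoid_le_two_pow_mul (B : ι → Set Ω) (p : ι → ℝ) (bad : Finset ι)
    (h : ∀ S ⊆ bad, ∀ a ∈ bad, ((inAvoid (B a) B S).card : ℝ) ≤ 2 * p a * (avoid B S).card)
    (s : ℕ) (R : Fin s → Finset ι) (hR : ∀ i, R i ⊆ bad) (hRs : ∀ i, ∑ b ∈ R i, p b ≤ 1 / 4)
    (T : Finset ι) (hT : T ⊆ bad) (hcov : ∀ b ∈ bad, b ∈ T ∨ ∃ i, b ∈ R i) :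
    ((avoid B T).card : ℝ) ≤ 2 ^ s * (avoid B bad).card := by
  classical
  induction s generalizing T with
  | zero =>
    have : bad ⊆ T := fun b hb => by simpa using hcov b hb
    simpa using (by exact_mod_cast card_le_card (avoid_anti B this) :
      ((avoid B T).card : ℝ) ≤ (avoid B bad).card)
  | succ s ih =>
    have h1 := card_avoid_le_two_mul B p T (R 0) (T ∪ R 0) subset_rfl
      (fun a ha => h T hT a (hR 0 ha)) (hRs 0)
    have h2 := ih (fun i => R i.succ) (fun i => hR _) (fun i => hRs _) (T ∪ R 0)
      (union_subset hT (hR 0)) (by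
        intro b hb
        rcases hcov b hb with hb | ⟨i, hi⟩
        · exact Or.inl (mem_union_left _ hb)
        · induction i using Fin.cases with
          | zero => exact Or.inl (mem_union_right _ hi)
          | succ i => exact Or.inr ⟨i, hi⟩)
    rw [pow_succ]
    nlinarith

/-! ### Lopsidedness for uniformly random bijections -/

section Lopsided

variable {X Y κ β : Type*} [Fintype X] [Fintype Y] [Fintype κ]

/-- A permutation that carries `y i` to `z i` and moves nothing outside the two ranges. -/
theorem exists_perm_extend (y z : κ ↪ Y) :
    ∃ ρ : Equiv.Perm Y, (∀ i, ρ (y i) = z i) ∧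
      ∀ w, w ∉ Set.range y → w ∉ Set.range z → ρ w = w := by
  classical
  let P : Y → Prop := fun w => w ∈ Set.range y ∨ w ∈ Set.range z
  let y' : κ ↪ Subtype P := ⟨fun i => ⟨y i, Or.inl ⟨i, rfl⟩⟩, fun i j h => y.injective (by simpa using h)⟩
  let z' : κ ↪ Subtype P := ⟨fun i => ⟨z i, Or.inr ⟨i, rfl⟩⟩, fun i j h => z.injective (by simpa using h)⟩
  let e : {w // w ∈ Set.range y'} ≃ {w // w ∈ Set.range z'} :=
    (Equiv.ofInjective y' y'.injective).symm.trans (Equiv.ofInjective z' z'.injective)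
  refine ⟨Equiv.Perm.ofSubtype e.extendSubtype, fun i => ?_, fun w hy hz => ?_⟩
  · have h1 : e.extendSubtype (y' i) = z' i := by
      rw [Equiv.extendSubtype_apply_of_mem e (y' i) ⟨i, rfl⟩]
      have : (Equiv.ofInjective y' y'.injective).symm ⟨y' i, ⟨i, rfl⟩⟩ = i := by
        rw [Equiv.symm_apply_eq]; rfl
      simp only [e, Equiv.trans_apply, this]
      rfl
    have h2 := Equiv.Perm.ofSubtype_apply_coe e.extendSubtype (y' i)
    rw [h1] at h2
    exact h2
  · exact Equiv.Perm.ofSubtype_apply_of_not_mem _ (by simp only [P, not_or]; exact ⟨hy, hz⟩)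

/-- The bijections that extend the partial map `u i ↦ v i`. -/
def extending {κ : Type*} (u : κ → X) (v : κ → Y) : Set (X ≃ Y) := {π | ∀ i, π (u i) = v i}

variable [Fintype (X ≃ Y)]

/-- Prescribing values of a random bijection does not help to avoid events that involve neither
the prescribed arguments nor the prescribed values. -/
theorem card_inAvoid_mul_card_embedding_le [Fintype (κ ↪ Y)] {D : β → Type*}
    (u : ∀ b, D b → X) (v : ∀ b, D b → Y) (S : Finset β) (x : κ ↪ X) (y : κ ↪ Y)
    (hx : ∀ b ∈ S, ∀ z, u b z ∉ Set.range x) (hy : ∀ b ∈ S, ∀ z, v b z ∉ Set.range y) :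
    (inAvoid (extending x y) (fun b => extending (u b) (v b)) S).card * Fintype.card (κ ↪ Y) ≤
      (avoid (fun b => extending (u b) (v b)) S).card := by
  classical
  set B : β → Set (X ≃ Y) := fun b => extending (u b) (v b)
  -- Composing with `ρ` switches the prescribed values from `y` to `z`. If the new bijection lay in
  -- an event `b`, its values on `u b` would avoid `z` (those are taken on `x`) and avoid `y` by
  -- hypothesis, so `ρ` fixes them and the old bijection already lay in `b`. Summing over the
  -- disjoint classes indexed by `z` gives the bound.
  have key : ∀ z : κ ↪ Y,
      (inAvoid (extending x y) B S).card ≤ (inAvoid (extending x z) B S).card := by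
    intro z
    obtain ⟨ρ, hρ, hfix⟩ := exists_perm_extend y z
    refine card_le_card_of_injOn (fun π => π.trans ρ) ?_ ?_
    · intro π hπ
      simp only [inAvoid, coe_filter, mem_univ, true_and, Set.mem_ofPred_eq] at hπ ⊢
      have h1 : ∀ i, ρ (π (x i)) = z i := fun i => by rw [hπ.1 i, hρ]
      refine ⟨h1, fun b hb hmem => hπ.2 b hb fun w => ?_⟩
      have h2 : ρ (π (u b w)) = v b w := hmem w
      have h3 : v b w ∉ Set.range z := by
        rintro ⟨i, hi⟩
        refine hx b hb w ⟨i, ?_⟩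
        apply π.injective
        apply ρ.injective
        rw [h1, h2, hi]
      apply ρ.injective
      rw [h2, hfix _ (hy b hb w) h3]
    · intro π _ π' _ h
      ext a
      have := congrArg (fun f : X ≃ Y => f a) h
      exact ρ.injective this
  have hdisj : ((univ : Finset (κ ↪ Y)) : Set (κ ↪ Y)).PairwiseDisjoint
      fun z => inAvoid (extending x z) B S := by
    intro z _ z' _ hzz
    refine Finset.disjoint_left.2 fun π h h' => hzz ?_
    simp only [inAvoid, mem_filter, mem_univ, true_and] at h h'
    ext i
    rw [← h.1 i, ← h'.1 i]
  calc _ = ∑ _z : κ ↪ Y, (inAvoid (extending x y) B S).card := by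
        rw [sum_const, smul_eq_mul, mul_comm]; rfl
    _ ≤ ∑ z : κ ↪ Y, (inAvoid (extending x z) B S).card := sum_le_sum fun z _ => key z
    _ = ((univ : Finset (κ ↪ Y)).biUnion fun z => inAvoid (extending x z) B S).card := (card_biUnion hdisj).symm
    _ ≤ _ := by
      refine card_le_card fun π hπ => ?_
      obtain ⟨z, -, hz⟩ := mem_biUnion.1 hπ
      simp only [inAvoid, avoid, mem_filter, mem_univ, true_and] at hz ⊢
      exact hz.2

end Lopsided

/-! ### Spread bijections without bad blocks -/

section Blocks

theorem card_inAvoid_mul_descFactorial_le {X Y κ β : Type*} [Fintype X] [Fintype Y] [Fintype κ]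
    [Fintype (X ≃ Y)] {D : β → Type*}
    (u : ∀ b, D b → X) (v : ∀ b, D b → Y) (S : Finset β) (x : κ ↪ X) (y : κ ↪ Y)
    (hx : ∀ b ∈ S, ∀ z, u b z ∉ Set.range x) (hy : ∀ b ∈ S, ∀ z, v b z ∉ Set.range y) :
    ((inAvoid (extending x y) (fun b => extending (u b) (v b)) S).card : ℝ) *
      (Fintype.card Y).descFactorial (Fintype.card κ) ≤
      (avoid (fun b => extending (u b) (v b)) S).card := by
  classical
  have := card_inAvoid_mul_card_embedding_le u v S x y hx hy
  rw [Fintype.card_embedding_eq] at this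
  exact_mod_cast this

theorem sum_biUnion_le_sum_sum {α β : Type*} [DecidableEq β] (s : Finset α) (f : α → Finset β)
    (p : β → ℝ) (hp : ∀ b, 0 ≤ p b) : ∑ b ∈ s.biUnion f, p b ≤ ∑ a ∈ s, ∑ b ∈ f a, p b := by
  classical
  induction s using Finset.induction_on with
  | empty => simp
  | insert a s ha ih =>
    rw [biUnion_insert, sum_insert ha]
    refine le_trans ?_ (add_le_add_right ih _)
    rw [← sum_union_inter]
    exact le_add_of_nonneg_right (sum_nonneg fun b _ => hp b)

open Classical in
/-- If, in each block of `X`, few injections have a bad range, then there is a set `Q` of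
bijections `X ≃ Y` mapping no block onto a bad set, such that a uniformly random element of `Q` is
spread. -/
theorem exists_spread_bijections {X Y J : Type*} [Fintype X] [Fintype Y] [Fintype J]
    [DecidableEq J]
    (b : X → J) (hb : Function.Surjective b) (n M : ℕ) (hX : Fintype.card X = n)
    (hY : Fintype.card Y = n) (hM : ∀ j, Fintype.card {x // b x = j} ≤ M) (hM1 : 1 ≤ M)
    (Bad : Finset Y → Prop) (η : ℝ) (hη0 : 0 ≤ η) (hη : η * (1 + M) ≤ 1 / 4)
    (hcount : ∀ j y, ((univ.filter fun σ : {x // b x = j} ↪ Y =>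
      y ∈ Set.range σ ∧ Bad (univ.map σ)).card : ℝ) ≤
        η * (Fintype.card {x // b x = j} / n) * n.descFactorial (Fintype.card {x // b x = j})) :
    ∃ Q : Finset (X ≃ Y), Q.Nonempty ∧
      (∀ π ∈ Q, ∀ j, ¬ Bad ((univ.filter fun x => b x = j).map π.toEmbedding)) ∧
      ∀ (s : ℕ) (x : Fin s ↪ X) (y : Fin s ↪ Y),
        ((Q.filter fun π => ∀ i, π (x i) = y i).card : ℝ) * n.descFactorial s ≤
          2 ^ s * Q.card := by
  let m : J → ℕ := fun j => Fintype.card {x // b x = j}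
  have hmn : ∀ j, m j ≤ n := fun j => hX ▸ Fintype.card_subtype_le _
  have hm0 : ∀ j, 0 < m j := fun j => by
    obtain ⟨x, hx⟩ := hb j
    exact Fintype.card_pos_iff.2 ⟨⟨x, hx⟩⟩
  have hsum : ∑ j, (m j : ℝ) = n := by
    rw [← hX, ← Fintype.card_congr (Equiv.sigmaFiberEquiv b), Fintype.card_sigma]
    push_cast
    rfl
  have hdf : ∀ j, (0 : ℝ) < n.descFactorial (m j) := fun j => by
    exact_mod_cast Nat.descFactorial_pos.2 (hmn j)
  -- An event is a block together with an injection of it into `Y`; its weight `p` is the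
  -- probability that a uniform bijection extends this injection. Two events are neighbours if they
  -- share the block or a value.
  let β := Σ j, ({x // b x = j} ↪ Y)
  let p : β → ℝ := fun a => 1 / n.descFactorial (m a.1)
  have hp : ∀ a, 0 ≤ p a := fun a => by positivity
  let bad : Finset β := univ.filter fun a => Bad (univ.map a.2)
  let u : ∀ a : β, {x // b x = a.1} → X := fun a => Subtype.val
  let v : ∀ a : β, {x // b x = a.1} → Y := fun a => a.2
  let B : β → Set (X ≃ Y) := fun a => extending (u a) (v a)
  let N : β → β → Prop := fun a c => a.1 = c.1 ∨ ∃ z, z ∈ Set.range a.2 ∧ z ∈ Set.range c.2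
  have hn0 : ∀ _ : Y, (0 : ℝ) < n := fun y => by
    have : Nonempty Y := ⟨y⟩
    exact_mod_cast hY ▸ Fintype.card_pos
  have sumY : ∀ y, ∑ c ∈ bad with y ∈ Set.range c.2, p c ≤ η := by
    intro y
    have e1 : ∑ c ∈ bad with y ∈ Set.range c.2, p c = ∑ j, ((univ.filter fun σ :
        {x // b x = j} ↪ Y => y ∈ Set.range σ ∧ Bad (univ.map σ)).card : ℝ) *
          (1 / n.descFactorial (m j)) := by
      rw [filter_filter, sum_filter, Fintype.sum_sigma]
      refine sum_congr rfl fun j _ => ?_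
      simp only [p]
      rw [← sum_filter, sum_const, nsmul_eq_mul]
      congr 3
      ext σ
      simp [and_comm]
    rw [e1]
    calc _ ≤ ∑ j, η * (m j / n) := by
          refine sum_le_sum fun j _ => ?_
          rw [mul_one_div, div_le_iff₀ (hdf j)]
          exact hcount j y
      _ = η := by
          rw [← mul_sum, ← sum_div, hsum, div_self (hn0 y).ne', mul_one]
  have sumX : ∀ j, ∑ c ∈ bad with c.1 = j, p c ≤ η := by
    intro j
    have e1 : ∑ c ∈ bad with c.1 = j, p c = ((univ.filter fun σ :
        {x // b x = j} ↪ Y => Bad (univ.map σ)).card : ℝ) * (1 / n.descFactorial (m j)) := by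
      rw [filter_filter, sum_filter, Fintype.sum_sigma, sum_eq_single j]
      · simp only [p]
        rw [← sum_filter, sum_const, nsmul_eq_mul]
        congr 3
        ext σ
        simp
      · intro j' _ hj
        exact sum_eq_zero fun σ _ => by simp [hj]
      · simp
    -- Double counting of pairs (bad injection, point of its range), so that the hypothesis per
    -- point `y` also bounds the total weight in a block.
    have e2 : ((univ.filter fun σ : {x // b x = j} ↪ Y => Bad (univ.map σ)).card : ℝ) * m j =
        ∑ y, ((univ.filter fun σ : {x // b x = j} ↪ Y =>
          y ∈ Set.range σ ∧ Bad (univ.map σ)).card : ℝ) := by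
      have h := sum_card_bipartiteAbove_eq_sum_card_bipartiteBelow
        (α := {x // b x = j} ↪ Y)
        (s := univ.filter fun σ => Bad (univ.map σ)) (t := univ) (fun σ y => y ∈ Set.range σ)
      have h1 : ∀ σ : {x // b x = j} ↪ Y,
          (bipartiteAbove (fun (σ : {x // b x = j} ↪ Y) y => y ∈ Set.range σ) univ σ).card
            = m j := by
        intro σ
        have : bipartiteAbove (fun (σ : {x // b x = j} ↪ Y) y => y ∈ Set.range σ) univ σ =
            univ.map σ := by ext; simp [bipartiteAbove]
        rw [this, card_map]
        rfl
      rw [sum_congr rfl fun σ _ => h1 σ, sum_const, smul_eq_mul] at h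
      have h2 : ∀ y, (bipartiteBelow (fun (σ : {x // b x = j} ↪ Y) y => y ∈ Set.range σ)
          (univ.filter fun σ : {x // b x = j} ↪ Y => Bad (univ.map σ)) y) =
          univ.filter fun σ : {x // b x = j} ↪ Y => y ∈ Set.range σ ∧ Bad (univ.map σ) := by
        intro y
        ext σ
        simp [bipartiteBelow, and_comm]
      simp only [h2] at h
      exact_mod_cast h
    have hmj : (0 : ℝ) < m j := by exact_mod_cast hm0 j
    have hn : (0 : ℝ) < n := lt_of_lt_of_le hmj (by exact_mod_cast hmn j)
    have e3 : ((univ.filter fun σ : {x // b x = j} ↪ Y => Bad (univ.map σ)).card : ℝ) * m j ≤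
        η * n.descFactorial (m j) * m j := by
      rw [e2]
      refine (sum_le_sum fun y _ => hcount j y).trans ?_
      rw [sum_const, card_univ, hY, nsmul_eq_mul]
      apply le_of_eq
      change (n : ℝ) * (η * (m j / n) * n.descFactorial (m j)) = _
      field_simp
    rw [e1, mul_one_div, div_le_iff₀ (hdf j)]
    exact le_of_mul_le_mul_right e3 hmj
  have hlopB : ∀ a ∈ bad, ∀ S ⊆ bad, (∀ c ∈ S, ¬ N a c) →
      ((inAvoid (B a) B S).card : ℝ) ≤ p a * (avoid B S).card := by
    intro a _ S _ hN
    have h := card_inAvoid_mul_descFactorial_le u v S (Function.Embedding.subtype _) a.2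
      (by
        rintro c hc ⟨z, hz⟩ ⟨w, hw⟩
        have hw' : (w : X) = z := hw
        exact hN c hc (Or.inl (by rw [← hz, ← hw', w.2])))
      (by
        rintro c hc z ⟨w, hw⟩
        exact hN c hc (Or.inr ⟨c.2 z, ⟨w, hw⟩, ⟨z, rfl⟩⟩))
    rw [hY] at h
    change _ ≤ 1 / _ * _
    rw [one_div_mul_eq_div, le_div_iff₀ (hdf _)]
    exact h
  -- Neighbours sharing the block weigh at most `η`, and those through each of the at most `M`
  -- values of `a` again at most `η`.
  have hsumN : ∀ a ∈ bad, ∑ c ∈ bad with N a c, p c ≤ 1 / 4 := by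
    intro a _
    have hsub : bad.filter (N a) ⊆ (bad.filter fun c => c.1 = a.1) ∪
        (univ.map a.2).biUnion fun y => bad.filter fun c => y ∈ Set.range c.2 := by
      intro c hc
      obtain ⟨hc, h⟩ := mem_filter.1 hc
      rcases h with h | ⟨z, ⟨w, rfl⟩, hz⟩
      · exact mem_union_left _ (mem_filter.2 ⟨hc, h.symm⟩)
      · exact mem_union_right _ (mem_biUnion.2 ⟨a.2 w, mem_map_of_mem _ (mem_univ _),
          mem_filter.2 ⟨hc, hz⟩⟩)
    have hU := sum_biUnion_le_sum_sum (univ.map a.2)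
      (fun y => bad.filter fun c => y ∈ Set.range c.2) p hp
    have hU' : ∑ y ∈ univ.map a.2, ∑ c ∈ bad with y ∈ Set.range c.2, p c ≤ M * η := by
      refine (sum_le_sum fun y _ => sumY y).trans ?_
      rw [sum_const, card_map, card_univ, nsmul_eq_mul]
      exact mul_le_mul_of_nonneg_right (by exact_mod_cast hM a.1) hη0
    have hT := sum_le_sum_of_subset_of_nonneg hsub fun c _ _ => hp c
    have hT' : ∑ c ∈ (bad.filter fun c => c.1 = a.1) ∪
        (univ.map a.2).biUnion (fun y => bad.filter fun c => y ∈ Set.range c.2), p c ≤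
        η + M * η := by
      refine le_trans ?_ (add_le_add (sumX a.1) (hU.trans hU'))
      rw [← sum_union_inter]
      exact le_add_of_nonneg_right (sum_nonneg fun c _ => hp c)
    linarith
  have hmain := card_inAvoid_le B p hp bad N hlopB fun a ha => by
    convert hsumN a ha
  have hne : Nonempty (X ≃ Y) := ⟨Fintype.equivOfCardEq (hX.trans hY.symm)⟩
  have hQ := avoid_nonempty B p bad (fun a ha => (single_le_sum (f := p) (fun c _ => hp c)
    (mem_filter.2 ⟨ha, Or.inl rfl⟩)).trans (hsumN a ha)) hmain
  refine ⟨avoid B bad, hQ, fun π hπ j hj => ?_, fun s x y => ?_⟩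
  · simp only [avoid, mem_filter, mem_univ, true_and] at hπ
    refine hπ ⟨j, (Function.Embedding.subtype _).trans π.toEmbedding⟩ ?_ fun z => rfl
    rw [mem_filter]
    refine ⟨mem_univ _, ?_⟩
    convert hj
    ext w
    simp only [mem_map, mem_univ, Function.Embedding.trans_apply, Function.Embedding.subtype_apply,
      Equiv.coe_toEmbedding, true_and, Subtype.exists, mem_filter, exists_prop]
  -- `R i` holds the events that interfere with the prescription `x i ↦ y i`, of weight at most `2 *
  -- η ≤ 1 / 4`. The events in `T` interfere with none, so lopsidedness applies to the whole
  -- prescription; returning to `bad` costs `2 ^ s`.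
  · let R : Fin s → Finset β := fun i => bad.filter fun c => c.1 = b (x i) ∨ y i ∈ Set.range c.2
    let T := bad.filter fun c => ∀ i, ¬ (c.1 = b (x i) ∨ y i ∈ Set.range c.2)
    have h1 := card_avoid_le_two_pow_mul B p bad hmain s R (fun i => filter_subset _ _)
      (fun i => by
        have hM1' : (1 : ℝ) ≤ M := by exact_mod_cast hM1
        have h3 : ∑ c ∈ R i, p c ≤ η + η := by
          simp only [R]
          rw [filter_or]
          refine le_trans ?_ (add_le_add (sumX (b (x i))) (sumY (y i)))
          rw [← sum_union_inter]
          exact le_add_of_nonneg_right (sum_nonneg fun c _ => hp c)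
        nlinarith) T (filter_subset _ _) (by
        intro c hc
        by_cases h : ∃ i, c.1 = b (x i) ∨ y i ∈ Set.range c.2
        · obtain ⟨i, hi⟩ := h
          exact Or.inr ⟨i, mem_filter.2 ⟨hc, hi⟩⟩
        · exact Or.inl (mem_filter.2 ⟨hc, not_exists.1 h⟩))
    have h2 := card_inAvoid_mul_descFactorial_le u v T x y
      (by
        rintro c hc ⟨z, hz⟩ ⟨i, hi⟩
        have hi' : x i = z := hi
        exact (mem_filter.1 hc).2 i (Or.inl (by rw [hi', hz])))
      (by
        rintro c hc z ⟨i, hi⟩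
        exact (mem_filter.1 hc).2 i (Or.inr ⟨z, hi.symm⟩))
    rw [Fintype.card_fin, hY] at h2
    refine le_trans (le_trans ?_ h2) h1
    refine mul_le_mul_of_nonneg_right ?_ (Nat.cast_nonneg _)
    have : (avoid B bad).filter (fun π => ∀ i, π (x i) = y i) ⊆
        inAvoid (extending x y) B T := by
      intro π hπ
      simp only [avoid, inAvoid, mem_filter, mem_univ, true_and] at hπ ⊢
      exact ⟨hπ.2, fun c hc => hπ.1 c (filter_subset _ _ hc)⟩
    exact_mod_cast card_le_card this

end Blocks

end LocalLemma

/-! ### Concentration for random sets and inheritance of minimum degree -/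

namespace HypergraphSampling

open Finset

/-- Since `(1 - t + t ^ 2 / 2) * (1 + t + t ^ 2 / 2) = 1 + t ^ 4 / 4 ≥ 1` and the second factor is
at most `exp t`, the first is at least `exp (-t)`. -/
theorem one_sub_exp_neg_ge {t : ℝ} (ht : 0 ≤ t) : t - t ^ 2 / 2 ≤ 1 - Real.exp (-t) := by
  have h1 := Real.quadratic_le_exp_of_nonneg ht
  have h2 : Real.exp (-t) * Real.exp t = 1 := by rw [← Real.exp_add]; simp
  have h3 : 0 < Real.exp (-t) := Real.exp_pos _
  have h4 : 0 ≤ 1 - t + t ^ 2 / 2 := by nlinarith [sq_nonneg (t - 1)]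
  have h5 : (1 - t + t ^ 2 / 2) * (1 + t + t ^ 2 / 2) = 1 + t ^ 4 / 4 := by ring
  have h6 : 0 ≤ t ^ 4 := by positivity
  have h7 : 1 ≤ (1 - t + t ^ 2 / 2) * Real.exp t := by
    have := mul_le_mul_of_nonneg_left h1 h4
    linarith
  have h8 : Real.exp (-t) ≤ 1 - t + t ^ 2 / 2 := by
    have := mul_le_mul_of_nonneg_left h7 h3.le
    nlinarith
  linarith

open Classical in
/-- Exponential moment bound for the number of hits among `q` independent samples. -/
theorem sum_exp_neg_card_le {T : Type*} [Fintype T] (G : T → Prop) (q : ℕ) {β t : ℝ}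
    (hβ0 : 0 ≤ β) (hβ1 : β ≤ 1) (ht : 0 ≤ t)
    (hG : β * Fintype.card T ≤ (univ.filter G).card) :
    ∑ w : Fin q → T, Real.exp (-t * (univ.filter fun j => G (w j)).card) ≤
      (Fintype.card T : ℝ) ^ q * Real.exp (-q * (t * β - t ^ 2 / 2)) := by
  have e1 : ∀ w : Fin q → T, Real.exp (-t * (univ.filter fun j => G (w j)).card) =
      ∏ j, if G (w j) then Real.exp (-t) else 1 := by
    intro w
    rw [prod_ite, prod_const, prod_const_one, mul_one, ← Real.exp_nat_mul, mul_comm]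
  have e2 : ∑ x : T, (if G x then Real.exp (-t) else 1) ≤
      Fintype.card T * Real.exp (-(t * β - t ^ 2 / 2)) := by
    have h1 : ∑ x : T, (if G x then Real.exp (-t) else 1) =
        Fintype.card T - (1 - Real.exp (-t)) * (univ.filter G).card := by
      have : ∀ x, (if G x then Real.exp (-t) else 1) =
          1 - (1 - Real.exp (-t)) * (if G x then 1 else 0) := by
        intro x; split_ifs <;> ring
      simp_rw [this]
      rw [sum_sub_distrib, ← mul_sum, sum_boole]
      simp
    have h2 := one_sub_exp_neg_ge ht
    have h3 : 0 ≤ 1 - Real.exp (-t) := by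
      have : Real.exp (-t) ≤ 1 := Real.exp_le_one_iff.2 (by linarith)
      linarith
    have h4 := mul_le_mul_of_nonneg_left hG h3
    have h5 : (1 - (1 - Real.exp (-t)) * β) ≤ Real.exp (-(t * β - t ^ 2 / 2)) := by
      have h6 := Real.add_one_le_exp (-(t * β - t ^ 2 / 2))
      have h7 := mul_le_mul_of_nonneg_right h2 hβ0
      have h8 : t ^ 2 / 2 * β ≤ t ^ 2 / 2 * 1 := mul_le_mul_of_nonneg_left hβ1 (by positivity)
      nlinarith
    have h9 := mul_le_mul_of_nonneg_left h5 (Nat.cast_nonneg (α := ℝ) (Fintype.card T))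
    rw [h1]
    linarith
  have h0 : 0 ≤ ∑ x : T, (if G x then Real.exp (-t) else 1) :=
    sum_nonneg fun x _ => by split_ifs <;> positivity
  calc _ = (∑ x : T, (if G x then Real.exp (-t) else 1)) ^ q := by
        rw [Fintype.sum_pow]
        exact sum_congr rfl fun w _ => e1 w
    _ ≤ (Fintype.card T * Real.exp (-(t * β - t ^ 2 / 2))) ^ q := pow_le_pow_left₀ h0 e2 q
    _ = _ := by
        rw [mul_pow, ← Real.exp_nat_mul]
        congr 2
        ring

theorem exists_perm_map_eq {P : Type*} [Fintype P] {B B' : Finset P} (h : B.card = B'.card) :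
    ∃ ρ : Equiv.Perm P, B.map ρ.toEmbedding = B' := by
  classical
  let y : Fin B.card ↪ P := B.equivFin.symm.toEmbedding.trans (Function.Embedding.subtype _)
  let z : Fin B.card ↪ P :=
    (B'.equivFinOfCardEq h.symm).symm.toEmbedding.trans (Function.Embedding.subtype _)
  obtain ⟨ρ, hρ, -⟩ := LocalLemma.exists_perm_extend y z
  refine ⟨ρ, eq_of_subset_of_card_le ?_ (by rw [card_map, h])⟩
  intro w hw
  obtain ⟨v, hv, rfl⟩ := mem_map.1 hw
  have h1 : y (B.equivFin ⟨v, hv⟩) = v := by simp [y]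
  have h2 := hρ (B.equivFin ⟨v, hv⟩)
  rw [h1] at h2
  change ρ v ∈ B'
  rw [h2]
  exact ((B'.equivFinOfCardEq h.symm).symm (B.equivFin ⟨v, hv⟩)).2

open Classical in
/-- The image of a fixed set under a random permutation is a uniformly random set. -/
theorem card_perm_mul_choose {P : Type*} [Fintype P] (l : ℕ) (A : Finset P) (hA : A.card = l)
    (G : Finset P → Prop) :
    (univ.filter fun g : Equiv.Perm P => G (A.map g.toEmbedding)).card *
      (Fintype.card P).choose l =
    (Fintype.card P).factorial * ((powersetCard l univ).filter G).card := by
  let c : Finset P → ℕ := fun B =>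
    (univ.filter fun g : Equiv.Perm P => A.map g.toEmbedding = B).card
  have hc : ∀ B ∈ powersetCard l (univ : Finset P), ∀ B' ∈ powersetCard l (univ : Finset P),
      c B ≤ c B' := by
    intro B hB B' hB'
    obtain ⟨ρ, hρ⟩ := exists_perm_map_eq
      ((mem_powersetCard.1 hB).2.trans (mem_powersetCard.1 hB').2.symm)
    refine card_le_card_of_injOn (fun g => g.trans ρ) ?_ ?_
    · intro g hg
      simp only [coe_filter, mem_univ, true_and, Set.mem_ofPred_eq] at hg ⊢
      rw [← hρ, ← hg, map_map]
      rfl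
    · intro g _ g' _ h
      ext a
      exact ρ.injective (congrArg (fun f : Equiv.Perm P => f a) h)
  have hAm : A ∈ powersetCard l (univ : Finset P) := mem_powersetCard.2 ⟨subset_univ _, hA⟩
  have hcA : ∀ B ∈ powersetCard l (univ : Finset P), c B = c A := fun B hB =>
    le_antisymm (hc B hB A hAm) (hc A hAm B hB)
  have hmaps : ∀ g : Equiv.Perm P, A.map g.toEmbedding ∈ powersetCard l (univ : Finset P) :=
    fun g => mem_powersetCard.2 ⟨subset_univ _, by rw [card_map, hA]⟩
  have htot : (Fintype.card P).factorial = (Fintype.card P).choose l * c A := by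
    rw [← Fintype.card_perm, ← card_univ, card_eq_sum_card_fiberwise
      (f := fun g : Equiv.Perm P => A.map g.toEmbedding) (t := powersetCard l univ)
      (fun g _ => hmaps g), sum_congr rfl hcA, sum_const, card_powersetCard, smul_eq_mul]
    rfl
  have hgood : (univ.filter fun g : Equiv.Perm P => G (A.map g.toEmbedding)).card =
      ((powersetCard l univ).filter G).card * c A := by
    rw [card_eq_sum_card_fiberwise
      (f := fun g : Equiv.Perm P => A.map g.toEmbedding) (t := (powersetCard l univ).filter G)
      (fun g hg => mem_filter.2 ⟨hmaps g, (mem_filter.1 hg).2⟩)]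
    rw [← smul_eq_mul, ← sum_const]
    refine sum_congr rfl fun B hB => ?_
    rw [← hcA B (filter_subset _ _ hB), filter_filter]
    congr 1
    ext g
    simp only [mem_filter, mem_univ, true_and, and_iff_right_iff_imp]
    rintro rfl
    exact (mem_filter.1 hB).2
  rw [hgood, htot]
  ring

open Classical in
/-- Hoeffding's inequality for the number of `l`-subsets of the sample that lie in a given family. -/
theorem card_sparse_le {P Y : Type*} [Fintype P] [Fintype Y] (q l : ℕ)
    (hP : Fintype.card P = q * l) (hq : 1 ≤ q) (L : Finset Y → Prop) {β γ : ℝ} (hβ0 : 0 ≤ β)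
    (hβ1 : β ≤ 1) (hγ : 0 ≤ γ)
    (hL : β * (Fintype.card Y : ℝ) ^ l ≤
      (univ.filter fun T : Fin l → Y => L (univ.image T)).card) :
    ((univ.filter fun w : P → Y =>
      (((powersetCard l univ).filter fun A => L (A.image w)).card : ℝ) ≤
        (β - γ) * (q * l).choose l).card : ℝ) ≤
      (Fintype.card Y : ℝ) ^ (q * l) * Real.exp (-q * (γ ^ 2 / 2)) := by
  -- Hoeffding's averaging trick: the `l`-subsets of `P` overlap and so are dependent, but a random
  -- permutation `g` turns `θ` into a random partition of `P` into `q` disjoint `l`-sets. `S w g`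
  -- records which parts are hit; for fixed `g` the parts are independent.
  let θ : Fin q × Fin l ≃ P := Fintype.equivOfCardEq (by simp [hP])
  let S : (P → Y) → Equiv.Perm P → Finset (Fin q) := fun w g =>
    univ.filter fun j => L (univ.image fun i => w (g (θ (j, i))))
  have f1 : ∀ g, ∑ w, Real.exp (-γ * (S w g).card) ≤
      (Fintype.card Y : ℝ) ^ (q * l) * Real.exp (-q * (γ * β - γ ^ 2 / 2)) := by
    intro g
    have h := sum_exp_neg_card_le (T := Fin l → Y) (fun T => L (univ.image T)) q hβ0 hβ1 hγ
      (by simpa using hL)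
    rw [Fintype.card_fun, Fintype.card_fin, Nat.cast_pow, ← pow_mul, mul_comm l q] at h
    refine le_trans (le_of_eq ?_) h
    exact Fintype.sum_equiv ((Equiv.arrowCongr (θ.trans g).symm (Equiv.refl Y)).trans
      (Equiv.curry _ _ _)) _ _ fun w => rfl
  -- Averaged over `g`, the number of parts hit is `q` times the density of hit `l`-sets.
  have f2 : ∀ w, (∑ g, ((S w g).card : ℝ)) * (q * l).choose l =
      (Fintype.card P).factorial * q *
        ((powersetCard l univ).filter fun A => L (A.image w)).card := by
    intro w
    have h1 : ∑ g, (S w g).card = ∑ j : Fin q, (univ.filter fun g : Equiv.Perm P =>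
        L (univ.image fun i => w (g (θ (j, i))))).card :=
      sum_card_bipartiteAbove_eq_sum_card_bipartiteBelow
        (s := univ) (t := univ) (fun (g : Equiv.Perm P) (j : Fin q) =>
          L (univ.image fun i => w (g (θ (j, i)))))
    have h2 : ∀ j : Fin q, (univ.filter fun g : Equiv.Perm P =>
        L (univ.image fun i => w (g (θ (j, i))))).card * (q * l).choose l =
        (Fintype.card P).factorial *
          ((powersetCard l univ).filter fun A => L (A.image w)).card := by
      intro j
      have h := card_perm_mul_choose l (univ.image fun i => θ (j, i))
        (by
          rw [card_image_of_injective _ fun a b h => by simpa using h]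
          simp) (fun A => L (A.image w))
      rw [hP] at h ⊢
      rw [← h]
      congr 3
      ext g
      rw [map_eq_image, image_image, image_image]
      rfl
    have h3 : (∑ g, (S w g).card) * (q * l).choose l = (Fintype.card P).factorial * q *
        ((powersetCard l univ).filter fun A => L (A.image w)).card := by
      rw [h1, sum_mul, sum_congr rfl fun j _ => h2 j, sum_const, card_univ, Fintype.card_fin,
        smul_eq_mul]
      ring
    exact_mod_cast h3
  set K : ℝ := ((Fintype.card P).factorial : ℝ) with hK
  have hK0 : 0 < K := by exact Nat.cast_pos.2 (Nat.factorial_pos _)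
  have hcardK : ((univ : Finset (Equiv.Perm P)).card : ℝ) = K := by
    rw [card_univ, Fintype.card_perm]
  have hch : (0 : ℝ) < (q * l).choose l := by
    exact_mod_cast Nat.choose_pos (Nat.le_mul_of_pos_left l hq)
  -- Jensen moves the average over `g` outside the exponential; Markov's inequality with parameter
  -- `γ` then leaves the exponent `-q * (γ ^ 2 / 2)`.
  have f3 : ∀ w, Real.exp (-γ * ((∑ g, ((S w g).card : ℝ)) / K)) ≤
      (∑ g, Real.exp (-γ * (S w g).card)) / K := by
    intro w
    have h := convexOn_exp.map_sum_le (t := (univ : Finset (Equiv.Perm P)))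
      (w := fun _ => 1 / K) (p := fun g => -γ * ((S w g).card : ℝ)) (fun _ _ => by positivity)
      (by rw [sum_const, nsmul_eq_mul, hcardK]; field_simp) (fun _ _ => Set.mem_univ _)
    simp only [smul_eq_mul] at h
    rw [← mul_sum, ← mul_sum, ← mul_sum] at h
    rw [one_div_mul_eq_div, one_div_mul_eq_div, ← mul_div_assoc'] at h
    exact h
  have f4 : ∀ w, (if (((powersetCard l univ).filter fun A => L (A.image w)).card : ℝ) ≤
        (β - γ) * (q * l).choose l then (1 : ℝ) else 0) ≤
      Real.exp (γ * q * (β - γ)) * ((∑ g, Real.exp (-γ * (S w g).card)) / K) := by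
    intro w
    split_ifs with hw
    · refine le_trans ?_ (mul_le_mul_of_nonneg_left (f3 w) (Real.exp_pos _).le)
      rw [← Real.exp_add]
      apply Real.one_le_exp
      have h1 : (∑ g, ((S w g).card : ℝ)) ≤ K * q * (β - γ) := by
        refine le_of_mul_le_mul_right ?_ hch
        rw [f2 w]
        have : (0 : ℝ) ≤ K * q := by positivity
        nlinarith [mul_le_mul_of_nonneg_left hw this]
      have h2 : (∑ g, ((S w g).card : ℝ)) / K ≤ q * (β - γ) := by
        rw [div_le_iff₀ hK0]
        linarith
      nlinarith [mul_le_mul_of_nonneg_left h2 hγ]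
    · positivity
  rw [← sum_boole]
  refine (sum_le_sum fun w _ => f4 w).trans ?_
  rw [← mul_sum, ← sum_div, sum_comm]
  have f5 : ∑ g : Equiv.Perm P, ∑ w, Real.exp (-γ * (S w g).card) ≤
      K * ((Fintype.card Y : ℝ) ^ (q * l) * Real.exp (-q * (γ * β - γ ^ 2 / 2))) := by
    refine (sum_le_sum fun g _ => f1 g).trans ?_
    rw [sum_const, nsmul_eq_mul, hcardK]
  have f6 := div_le_of_le_mul₀ hK0.le (by positivity) (f5.trans_eq (mul_comm _ _))
  refine (mul_le_mul_of_nonneg_left f6 (Real.exp_pos _).le).trans (le_of_eq ?_)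
  rw [mul_left_comm, ← Real.exp_add]
  congr 2
  ring

open Classical in
theorem card_functions_fixed {I Y : Type*} [Fintype I] [Fintype Y] (x₀ : I) (y : Y) :
    (univ.filter fun τ : I → Y => τ x₀ = y).card = Fintype.card Y ^ (Fintype.card I - 1) := by
  have h : (univ.filter fun τ : I → Y => τ x₀ = y) =
      Fintype.piFinset fun i => if i = x₀ then {y} else univ := by
    ext τ
    simp only [mem_filter, mem_univ, true_and, Fintype.mem_piFinset]
    constructor
    · rintro rfl i
      split_ifs with h <;> simp [h]
    · intro h
      simpa using h x₀
  rw [h, Fintype.card_piFinset, ← mul_prod_erase univ _ (mem_univ x₀), if_pos rfl, card_singleton,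
    one_mul, prod_congr rfl fun i hi => by rw [if_neg (mem_erase.1 hi).1], prod_const,
    card_erase_of_mem (mem_univ _), card_univ, card_univ]

open Classical in
/-- A random map sending `x₀` to `y` rarely makes the link of the image of `J` sparse. -/
theorem card_sparse_extension_le {I Y : Type*} [Fintype I] [Fintype Y] (q l d : ℕ) (hq : 1 ≤ q)
    (J J' : Finset I) (x₀ : I) (y : Y) (hJ : J ⊆ J') (hx₀ : x₀ ∈ J') (hJd : J.card = d)
    (hJ' : J'ᶜ.card = q * l) (E : Finset (Finset Y)) {β γ : ℝ} (hβ0 : 0 ≤ β)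
    (hβ1 : β ≤ 1) (hγ : 0 ≤ γ)
    (hL : ∀ D : Finset Y, D.card = d → β * (Fintype.card Y : ℝ) ^ l ≤
      (univ.filter fun T : Fin l → Y => univ.image T ∪ D ∈ E).card) :
    ((univ.filter fun σ : I → Y => σ x₀ = y ∧ Set.InjOn σ J ∧
      (((powersetCard l J'ᶜ).filter fun A => A.image σ ∪ J.image σ ∈ E).card : ℝ) ≤
        (β - γ) * (q * l).choose l).card : ℝ) ≤
      (Fintype.card Y : ℝ) ^ (Fintype.card I - 1) * Real.exp (-q * (γ ^ 2 / 2)) := by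
  let In := {i // i ∈ J'}
  let Out := {i // i ∉ J'}
  have hOut : Fintype.card Out = q * l := by
    rw [← hJ', Fintype.card_subtype]
    congr 1
    ext i
    simp
  have hIn : Fintype.card In = J'.card := Fintype.card_coe J'
  have hsplit : Fintype.card In + q * l = Fintype.card I := by
    rw [hIn, ← hJ', card_add_card_compl]
  let Jτ : (In → Y) → Finset Y := fun τ => univ.filter fun z => ∃ i : In, (i : I) ∈ J ∧ τ i = z
  let spr : (In → Y) → (Out → Y) → Prop := fun τ w =>
    (((powersetCard l univ).filter fun A => A.image w ∪ Jτ τ ∈ E).card : ℝ) ≤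
      (β - γ) * (q * l).choose l
  -- Reveal the map on `J'` first. This determines the `d`-set that is the image of `J` and uses up
  -- the constraint at `x₀`; the values off `J'` remain free, so the sampling bound applies to the
  -- link of that `d`-set.
  let tgt : Finset (Σ _ : In → Y, Out → Y) :=
    (univ.filter fun τ : In → Y => τ ⟨x₀, hx₀⟩ = y ∧ (Jτ τ).card = d).sigma
      fun τ => univ.filter (spr τ)
  have h1 : (univ.filter fun σ : I → Y => σ x₀ = y ∧ Set.InjOn σ J ∧
      (((powersetCard l J'ᶜ).filter fun A => A.image σ ∪ J.image σ ∈ E).card : ℝ) ≤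
        (β - γ) * (q * l).choose l).card ≤ tgt.card := by
    refine card_le_card_of_injOn (fun σ => ⟨fun i => σ i, fun i => σ i⟩) ?_ ?_
    · intro σ hσ
      simp only [coe_filter, mem_univ, true_and, Set.mem_ofPred_eq] at hσ
      obtain ⟨hy, hinj, hsp⟩ := hσ
      have hJτ : Jτ (fun i => σ i) = J.image σ := by
        ext z
        simp only [Jτ, mem_filter, mem_univ, true_and, mem_image]
        exact ⟨fun ⟨i, hi, h⟩ => ⟨i, hi, h⟩, fun ⟨i, hi, h⟩ => ⟨⟨i, hJ hi⟩, hi, h⟩⟩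
      simp only [tgt, coe_sigma, Set.mem_sigma_iff, coe_filter, mem_univ, true_and,
        Set.mem_ofPred_eq]
      refine ⟨⟨hy, by rw [hJτ, card_image_of_injOn hinj, hJd]⟩, le_trans ?_ hsp⟩
      refine Nat.cast_le.2 (card_le_card_of_injOn
        (fun A => A.map (Function.Embedding.subtype _)) ?_ ?_)
      · intro A hA
        simp only [coe_filter, mem_powersetCard, Set.mem_ofPred_eq, hJτ] at hA ⊢
        refine ⟨⟨fun i hi => ?_, by rw [card_map, hA.1.2]⟩, ?_⟩
        · obtain ⟨i, -, rfl⟩ := mem_map.1 hi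
          exact mem_compl.2 i.2
        · have : (A.map (Function.Embedding.subtype _)).image σ = A.image fun i : Out => σ i := by
            rw [map_eq_image, image_image]
            rfl
          rw [this]
          exact hA.2
      · exact fun A _ A' _ h => map_injective _ h
    · intro σ _ σ' _ h
      simp only [Sigma.mk.injEq, heq_eq_eq] at h
      ext i
      by_cases hi : i ∈ J'
      · exact congrFun h.1 ⟨i, hi⟩
      · exact congrFun h.2 ⟨i, hi⟩
  have h2 : (tgt.card : ℝ) ≤ (Fintype.card Y : ℝ) ^ (Fintype.card In - 1) *
      ((Fintype.card Y : ℝ) ^ (q * l) * Real.exp (-q * (γ ^ 2 / 2))) := by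
    rw [card_sigma, Nat.cast_sum]
    have h3 : ∀ τ ∈ univ.filter fun τ : In → Y => τ ⟨x₀, hx₀⟩ = y ∧ (Jτ τ).card = d,
        ((univ.filter (spr τ)).card : ℝ) ≤
          (Fintype.card Y : ℝ) ^ (q * l) * Real.exp (-q * (γ ^ 2 / 2)) := by
      intro τ hτ
      have hLτ := hL _ (mem_filter.1 hτ).2.2
      have h := card_sparse_le q l hOut hq (fun S => S ∪ Jτ τ ∈ E) hβ0 hβ1 hγ (by convert hLτ)
      convert h
    refine (sum_le_sum h3).trans ?_
    rw [sum_const, nsmul_eq_mul]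
    refine mul_le_mul_of_nonneg_right ?_ (by positivity)
    have hcf := card_functions_fixed (⟨x₀, hx₀⟩ : In) y
    have hle : (univ.filter fun τ : In → Y => τ ⟨x₀, hx₀⟩ = y ∧ (Jτ τ).card = d).card ≤
        (univ.filter fun τ : In → Y => τ ⟨x₀, hx₀⟩ = y).card :=
      card_le_card (monotone_filter_right _ fun τ _ hτ => hτ.1)
    rw [← Nat.cast_pow]
    exact Nat.cast_le.2 (hle.trans_eq (by convert hcf))
  have hpos : 0 < Fintype.card In := Fintype.card_pos_iff.2 ⟨⟨x₀, hx₀⟩⟩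
  refine (Nat.cast_le.2 h1).trans (h2.trans_eq ?_)
  rw [← mul_assoc, ← pow_add]
  congr 2
  omega

open Classical in
theorem factorial_le_card_image_eq {Y : Type*} [Fintype Y] (l : ℕ) (S : Finset Y)
    (hS : S.card = l) : l.factorial ≤ (univ.filter fun T : Fin l → Y => univ.image T = S).card := by
  have e : Fin l ≃ S := (S.equivFinOfCardEq hS).symm
  have h : Fintype.card (Fin l ≃ S) = l.factorial := by
    rw [Fintype.card_equiv e, Fintype.card_fin]
  rw [← h, ← card_univ]
  refine card_le_card_of_injOn (fun f i => (f i : Y)) ?_ ?_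
  · intro f _
    simp only [coe_filter, mem_univ, true_and, Set.mem_ofPred_eq]
    ext z
    simp only [mem_image, mem_univ, true_and]
    exact ⟨fun ⟨i, hi⟩ => hi ▸ (f i).2, fun hz => ⟨f.symm ⟨z, hz⟩, by simp⟩⟩
  · intro f _ g _ h
    ext i
    exact congrFun h i

open Classical in
/-- Each edge through `D` is hit by `l!` ordered `l`-tuples. -/
theorem factorial_mul_degree_le {Y : Type*} [Fintype Y] (l d : ℕ) (E : Finset (Finset Y))
    (hE : ∀ e ∈ E, e.card = d + l) (D : Finset Y) (hD : D.card = d) :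
    l.factorial * (E.filter fun e => D ⊆ e).card ≤
      (univ.filter fun T : Fin l → Y => univ.image T ∪ D ∈ E).card := by
  calc _ = ∑ _e ∈ E.filter fun e => D ⊆ e, l.factorial := by
        rw [sum_const, smul_eq_mul, mul_comm]
    _ ≤ ∑ e ∈ E.filter fun e => D ⊆ e,
        (univ.filter fun T : Fin l → Y => univ.image T = e \ D).card := by
      refine sum_le_sum fun e he => factorial_le_card_image_eq l _ ?_
      rw [card_sdiff_of_subset (mem_filter.1 he).2, hE e (mem_filter.1 he).1, hD]
      omega
    _ = ((E.filter fun e => D ⊆ e).biUnion fun e =>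
        univ.filter fun T : Fin l → Y => univ.image T = e \ D).card := by
      refine (card_biUnion ?_).symm
      intro e he e' he' hee
      refine Finset.disjoint_left.2 fun T hT hT' => hee ?_
      simp only [mem_filter, mem_univ, true_and] at hT hT'
      rw [← sdiff_union_of_subset (mem_filter.1 he).2, ← hT, hT',
        sdiff_union_of_subset (mem_filter.1 he').2]
    _ ≤ _ := by
      refine card_le_card fun T hT => ?_
      obtain ⟨e, he, hT⟩ := mem_biUnion.1 hT
      simp only [mem_filter, mem_univ, true_and] at hT ⊢
      rw [hT, sdiff_union_of_subset (mem_filter.1 he).2]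
      exact (mem_filter.1 he).1

open Classical in
/-- `U` induces a subhypergraph of `E` with a `d`-set of degree less than `c`. -/
def HasLowDegree {Y : Type*} (E : Finset (Finset Y)) (d : ℕ) (c : ℝ) (U : Finset Y) : Prop :=
  ∃ D ⊆ U, D.card = d ∧ ((E.filter fun e => D ⊆ e ∧ e ⊆ U).card : ℝ) < c

open Classical in
/-- A random injection with `y` in its range rarely has a range with a `d`-set of low degree. -/
theorem card_hasLowDegree_le {I Y : Type*} [Fintype I] [Fintype Y] (q l d t : ℕ) (hq : 1 ≤ q)
    (hI : t + q * l = Fintype.card I) (ht : d + 1 ≤ t) (E : Finset (Finset Y)) {β γ c : ℝ}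
    (hβ0 : 0 ≤ β) (hβ1 : β ≤ 1) (hγ : 0 ≤ γ)
    (hL : ∀ D : Finset Y, D.card = d → β * (Fintype.card Y : ℝ) ^ l ≤
      (univ.filter fun T : Fin l → Y => univ.image T ∪ D ∈ E).card)
    (hc : c ≤ (β - γ) * (q * l).choose l) (y : Y) :
    ((univ.filter fun σ : I ↪ Y => y ∈ Set.range σ ∧ HasLowDegree E d c (univ.map σ)).card : ℝ) ≤
      (Fintype.card I).choose d * Fintype.card I *
        ((Fintype.card Y : ℝ) ^ (Fintype.card I - 1) * Real.exp (-q * (γ ^ 2 / 2))) := by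
  -- Union bound over the preimage `J` of the low-degree set and the preimage `x` of `y`. Enlarging
  -- `J ∪ {x}` to size `t ≥ d + 1` leaves exactly `q * l` sample points.
  have hexJ : ∀ p : Finset I × I, p.1.card = d →
      ∃ J' : Finset I, p.1 ⊆ J' ∧ p.2 ∈ J' ∧ J'ᶜ.card = q * l := by
    rintro ⟨J, x⟩ hJ
    obtain ⟨J', h1, h2⟩ := exists_superset_card_eq (s := insert x J) (n := t)
      ((card_insert_le _ _).trans (by simp only at hJ; omega)) (by omega)
    refine ⟨J', (subset_insert _ _).trans h1, h1 (mem_insert_self _ _), ?_⟩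
    rw [card_compl]
    omega
  choose! J' hJ'1 hJ'2 hJ'3 using hexJ
  let F : Finset I × I → Finset (I → Y) := fun p => univ.filter fun σ : I → Y => σ p.2 = y ∧
    Set.InjOn σ p.1 ∧ (((powersetCard l (J' p)ᶜ).filter fun A =>
      A.image σ ∪ p.1.image σ ∈ E).card : ℝ) ≤ (β - γ) * (q * l).choose l
  have h1 : (univ.filter fun σ : I ↪ Y => y ∈ Set.range σ ∧
      HasLowDegree E d c (univ.map σ)).card ≤
      ((powersetCard d (univ : Finset I) ×ˢ (univ : Finset I)).biUnion F).card := by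
    refine card_le_card_of_injOn (fun σ => σ) ?_ fun σ _ σ' _ h => DFunLike.coe_injective h
    intro σ hσ
    simp only [coe_filter, mem_univ, true_and, Set.mem_ofPred_eq] at hσ
    obtain ⟨⟨x, hx⟩, D, hDU, hDd, hlow⟩ := hσ
    obtain ⟨J, -, rfl⟩ := subset_map_iff.1 hDU
    rw [card_map] at hDd
    simp only [coe_biUnion, Set.mem_iUnion, mem_coe]
    refine ⟨(J, x), mem_product.2 ⟨mem_powersetCard.2 ⟨subset_univ _, hDd⟩, mem_univ _⟩, ?_⟩
    simp only [F, mem_filter, mem_univ, true_and]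
    refine ⟨hx, σ.injective.injOn, le_trans ?_ (hlow.le.trans hc)⟩
    refine Nat.cast_le.2 (card_le_card_of_injOn (fun A => A.image σ ∪ J.image σ) ?_ ?_)
    · intro A hA
      simp only [coe_filter, mem_powersetCard, Set.mem_ofPred_eq] at hA ⊢
      rw [map_eq_image, map_eq_image]
      exact ⟨hA.2, subset_union_right, union_subset (image_subset_image (subset_univ _))
        (image_subset_image (subset_univ _))⟩
    · intro A hA A' hA' h
      simp only [coe_filter, mem_powersetCard, Set.mem_ofPred_eq] at hA hA' h
      rw [← image_union, ← image_union] at h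
      have h2 := image_injective σ.injective h
      have hdis : ∀ A : Finset I, A ⊆ (J' (J, x))ᶜ → Disjoint A J := fun A hA =>
        (disjoint_compl_left (a := J' (J, x))).mono hA (hJ'1 (J, x) hDd)
      rw [← union_sdiff_cancel_right (hdis A hA.1.1), h2,
        union_sdiff_cancel_right (hdis A' hA'.1.1)]
  have h2 : (((powersetCard d (univ : Finset I) ×ˢ (univ : Finset I)).biUnion F).card : ℝ) ≤
      ∑ p ∈ powersetCard d (univ : Finset I) ×ˢ (univ : Finset I), ((F p).card : ℝ) := by
    exact_mod_cast card_biUnion_le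
  refine (Nat.cast_le.2 h1).trans (h2.trans ?_)
  have h3 : ∀ p ∈ powersetCard d (univ : Finset I) ×ˢ (univ : Finset I), ((F p).card : ℝ) ≤
      (Fintype.card Y : ℝ) ^ (Fintype.card I - 1) * Real.exp (-q * (γ ^ 2 / 2)) := by
    intro p hp
    have hpd := (mem_powersetCard.1 (mem_product.1 hp).1).2
    exact card_sparse_extension_le q l d hq p.1 (J' p) p.2 y (hJ'1 p hpd) (hJ'2 p hpd) hpd
      (hJ'3 p hpd) E hβ0 hβ1 hγ hL
  refine (sum_le_sum h3).trans (le_of_eq ?_)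
  rw [sum_const, nsmul_eq_mul, card_product, card_powersetCard, card_univ, Nat.cast_mul]

open Filter

/-- Each factor of the falling factorial is at least `n - (c + l)`, and Bernoulli's inequality
bounds the relative loss by `l * (c + l) / n`. The shift `c` absorbs passing to `n - d` and to `q *
l`. -/
theorem exists_forall_pow_le_descFactorial (l c : ℕ) {κ : ℝ} (hκ : 0 < κ) :
    ∃ N : ℕ, ∀ n ≥ N, ∀ n', n ≤ n' + c → ∀ l' ≤ l,
      (1 - κ) * (n : ℝ) ^ l' ≤ n'.descFactorial l' := by
  obtain ⟨N₁, hN₁⟩ := exists_nat_ge (l * (c + l) / κ)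
  refine ⟨max N₁ (c + l + 1), fun n hn n' hn' l' hl' => ?_⟩
  have hn1 : N₁ ≤ n := (le_max_left _ _).trans hn
  have hn2 : c + l + 1 ≤ n := (le_max_right _ _).trans hn
  have hn0 : (0 : ℝ) < n := by exact_mod_cast (by omega : 0 < n)
  have h1 : ((n : ℝ) - (c + l)) ^ l' ≤ n'.descFactorial l' := by
    have h2 : (n - (c + l)) ^ l' ≤ n'.descFactorial l' :=
      (Nat.pow_le_pow_left (by omega) l').trans (Nat.pow_sub_le_descFactorial n' l')
    have h3 : ((n : ℝ) - (c + l)) = ((n - (c + l) : ℕ) : ℝ) := by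
      rw [Nat.cast_sub (by omega)]
      push_cast
      ring
    rw [h3]
    exact_mod_cast h2
  refine le_trans ?_ h1
  have h4 : (n : ℝ) - (c + l) = n * (1 + -((c + l) / n)) := by
    field_simp
    ring
  have h5 : ((c + l : ℝ)) / n ≤ 1 := by
    rw [div_le_one hn0]
    exact_mod_cast (by omega : c + l ≤ n)
  have h6 := one_add_mul_le_pow (a := -((c + l : ℝ) / n)) (by linarith) l'
  have h7 : (l' : ℝ) * ((c + l) / n) ≤ κ := by
    have h8 : (l * (c + l) : ℝ) ≤ n * κ := by
      rw [div_le_iff₀ hκ] at hN₁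
      exact hN₁.trans (mul_le_mul_of_nonneg_right (by exact_mod_cast hn1) hκ.le)
    rw [← mul_div_assoc, div_le_iff₀ hn0, mul_comm κ]
    refine le_trans (mul_le_mul_of_nonneg_right (by exact_mod_cast hl') (by positivity)) h8
  rw [h4, mul_pow, mul_comm]
  exact mul_le_mul_of_nonneg_left (by linarith) (by positivity)

theorem exists_forall_pow_mul_exp_le (k : ℕ) {c : ℝ} (hc : 0 < c) :
    ∃ N : ℕ, ∀ m ≥ N, (m : ℝ) ^ k * (8 * (1 + 2 * m)) * Real.exp (-(c * (m - k))) ≤ 1 := by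
  have h := (tendsto_pow_const_mul_const_pow_of_abs_lt_one (k + 1) (r := Real.exp (-c))
    (by rw [abs_of_pos (Real.exp_pos _)]; simpa using hc)).mul_const
      (24 * Real.exp (c * k))
  rw [zero_mul] at h
  have h1 := (h.eventually (gt_mem_nhds one_pos)).and (eventually_ge_atTop 1)
  obtain ⟨N, hN⟩ := eventually_atTop.1 h1
  refine ⟨N, fun m hm => ?_⟩
  obtain ⟨h2, h3⟩ := hN m hm
  have hm1 : (1 : ℝ) ≤ m := by exact_mod_cast h3
  refine le_trans ?_ h2.le
  have h4 : Real.exp (-(c * (m - k))) = Real.exp (-c) ^ m * Real.exp (c * k) := by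
    rw [← Real.exp_nat_mul, ← Real.exp_add]
    congr 1
    ring
  rw [h4, pow_succ]
  have h5 : (8 * (1 + 2 * m) : ℝ) ≤ 24 * m := by linarith
  calc (m : ℝ) ^ k * (8 * (1 + 2 * m)) * (Real.exp (-c) ^ m * Real.exp (c * k))
      ≤ (m : ℝ) ^ k * (24 * m) * (Real.exp (-c) ^ m * Real.exp (c * k)) := by gcongr
    _ = _ := by ring

open Classical in
/-- In a `k`-uniform hypergraph of large minimum `d`-degree, a random set of bounded size that
contains a given vertex inherits the minimum degree condition with high probability. -/
theorem exists_inherits_minDegree (k : ℕ) {α : ℝ} (hα : 0 < α) :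
    ∃ M₀ : ℕ, ∀ m ≥ M₀, ∃ n₀ : ℕ, ∀ n ≥ n₀, ∀ d, d < k → ∀ δ : ℝ, 0 ≤ δ → δ ≤ 1 →
      ∀ {I Y : Type*} [Fintype I] [Fintype Y], Fintype.card I = m → Fintype.card Y = n →
      ∀ E : Finset (Finset Y), (∀ e ∈ E, e.card = k) →
      (∀ D : Finset Y, D.card = d →
        (δ + α) * (n - d).choose (k - d) ≤ (E.filter fun e => D ⊆ e).card) →
      ∀ y : Y, ((univ.filter fun σ : I ↪ Y => y ∈ Set.range σ ∧
        HasLowDegree E d ((δ + α / 2) * (m - d).choose (k - d)) (univ.map σ)).card : ℝ) ≤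
          1 / (4 * (1 + 2 * m)) * (m / n) * n.descFactorial m := by
  set κ : ℝ := α / (8 * (1 + α)) with hκdef
  have hκ : 0 < κ := by positivity
  have hκα : κ * (8 * (1 + α)) = α := div_mul_cancel₀ _ (by positivity)
  set γ : ℝ := α / 8 with hγdef
  have hγ : 0 < γ := by positivity
  rcases Nat.eq_zero_or_pos k with rfl | hk
  · exact ⟨0, fun m _ => ⟨0, fun n _ d hd => absurd hd (Nat.not_lt_zero d)⟩⟩
  set c : ℝ := γ ^ 2 / 2 / k with hcdef
  have hk' : (0 : ℝ) < k := by exact_mod_cast hk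
  have hc : 0 < c := by positivity
  obtain ⟨N₁, hN₁⟩ := exists_forall_pow_le_descFactorial k k hκ
  obtain ⟨N₂, hN₂⟩ := exists_forall_pow_mul_exp_le k hc
  refine ⟨max (max N₁ N₂) (2 * k), fun m hm => ?_⟩
  have hm1 : N₁ ≤ m := (le_max_left _ _).trans ((le_max_left _ _).trans hm)
  have hm2 : N₂ ≤ m := (le_max_right _ _).trans ((le_max_left _ _).trans hm)
  have hm3 : 2 * k ≤ m := (le_max_right _ _).trans hm
  obtain ⟨N₃, hN₃⟩ := exists_forall_pow_le_descFactorial m 0 (κ := 1 / 2) (by norm_num)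
  refine ⟨max (max N₁ N₃) (k + 1), fun n hn d hd δ hδ0 hδ1 I Y _ _ hI hY E hE hdeg y => ?_⟩
  have hn1 : N₁ ≤ n := (le_max_left _ _).trans ((le_max_left _ _).trans hn)
  have hn3 : N₃ ≤ n := (le_max_right _ _).trans ((le_max_left _ _).trans hn)
  have hnk : k + 1 ≤ n := (le_max_right _ _).trans hn
  have hn0 : (0 : ℝ) < n := by exact_mod_cast (by omega : 0 < n)
  obtain ⟨l, rfl⟩ : ∃ l, k = d + l := ⟨k - d, by omega⟩
  have hl : 1 ≤ l := by omega
  simp only [Nat.add_sub_cancel_left] at hdeg ⊢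
  -- The subtracted `d + 1` reserves room for the `d`-set and the preimage of `y`; rounding wastes
  -- fewer than `l` further points.
  set q := (m - d - 1) / l with hq
  have hq1 : q * l ≤ m - d - 1 := Nat.div_mul_le_self _ _
  have hq2 : m ≤ q * l + (d + l) := by
    have := Nat.lt_div_mul_add (a := m - d - 1) (b := l) (by omega)
    rw [← hq] at this
    omega
  have hqpos : 1 ≤ q := (Nat.one_le_div_iff (by omega)).2 (by omega)
  have hlf : (0 : ℝ) < l.factorial := by exact_mod_cast Nat.factorial_pos _
  have hL : ∀ D : Finset Y, D.card = d → (δ + 3 * α / 4) * (Fintype.card Y : ℝ) ^ l ≤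
      (univ.filter fun T : Fin l → Y => univ.image T ∪ D ∈ E).card := by
    intro D hD
    have h1 := factorial_mul_degree_le l d E hE D hD
    have h2 : (l.factorial : ℝ) * (E.filter fun e => D ⊆ e).card ≤
        (univ.filter fun T : Fin l → Y => univ.image T ∪ D ∈ E).card := by exact_mod_cast h1
    refine le_trans ?_ h2
    refine le_trans ?_ (mul_le_mul_of_nonneg_left (hdeg D hD) hlf.le)
    have h3 := hN₁ n hn1 (n - d) (by omega) l (by omega)
    rw [Nat.descFactorial_eq_factorial_mul_choose, Nat.cast_mul] at h3
    rw [hY, mul_left_comm]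
    refine le_trans ?_ (mul_le_mul_of_nonneg_left h3 (by positivity))
    rw [← mul_assoc]
    refine mul_le_mul_of_nonneg_right ?_ (by positivity)
    nlinarith
  -- Forced by the degree condition itself: some `d`-set exists, and its link has at most `n ^ l`
  -- ordered tuples.
  have hβ1 : δ + 3 * α / 4 ≤ 1 := by
    obtain ⟨D, -, hD⟩ := exists_subset_card_eq (s := (univ : Finset Y)) (n := d)
      (by rw [card_univ, hY]; omega)
    have h1 := hL D hD
    have h2 : ((univ.filter fun T : Fin l → Y => univ.image T ∪ D ∈ E).card : ℝ) ≤
        (Fintype.card Y : ℝ) ^ l := by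
      have := card_filter_le (univ : Finset (Fin l → Y)) fun T => univ.image T ∪ D ∈ E
      rw [card_univ, Fintype.card_fun, Fintype.card_fin] at this
      exact_mod_cast this
    have h3 : (0 : ℝ) < (Fintype.card Y : ℝ) ^ l := by rw [hY]; positivity
    exact le_of_mul_le_mul_right (by linarith) h3
  have hcq : (δ + α / 2) * (m - d).choose l ≤
      (δ + 3 * α / 4 - γ) * (q * l).choose l := by
    refine le_of_mul_le_mul_left ?_ hlf
    have h3 := hN₁ m hm1 (q * l) hq2 l (by omega)
    rw [Nat.descFactorial_eq_factorial_mul_choose, Nat.cast_mul] at h3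
    have h4 : (l.factorial : ℝ) * (m - d).choose l ≤ (m : ℝ) ^ l := by
      rw [← Nat.cast_mul, ← Nat.descFactorial_eq_factorial_mul_choose]
      exact_mod_cast (Nat.descFactorial_le_pow _ _).trans (Nat.pow_le_pow_left (Nat.sub_le m d) l)
    calc (l.factorial : ℝ) * ((δ + α / 2) * (m - d).choose l)
        = (δ + α / 2) * (l.factorial * (m - d).choose l) := by ring
      _ ≤ (δ + α / 2) * (m : ℝ) ^ l := mul_le_mul_of_nonneg_left h4 (by positivity)
      _ ≤ (δ + 3 * α / 4 - γ) * (1 - κ) * (m : ℝ) ^ l := by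
        refine mul_le_mul_of_nonneg_right ?_ (by positivity)
        rw [hγdef]
        nlinarith
      _ = (δ + 3 * α / 4 - γ) * ((1 - κ) * (m : ℝ) ^ l) := by ring
      _ ≤ (δ + 3 * α / 4 - γ) * (l.factorial * (q * l).choose l) :=
        mul_le_mul_of_nonneg_left h3 (by rw [hγdef]; linarith)
      _ = _ := by ring
  have hmain := card_hasLowDegree_le (I := I) q l d (m - q * l) hqpos (by rw [hI]; omega)
    (by omega) E (by positivity) hβ1 hγ.le hL hcq y
  refine hmain.trans ?_
  rw [hI, hY]
  have hm0 : (0 : ℝ) < m := by exact_mod_cast (by omega : 0 < m)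
  have h1 : (1 - 1 / 2) * (n : ℝ) ^ m ≤ n.descFactorial m := hN₃ n hn3 n le_rfl m le_rfl
  have h2 : ((m.choose d : ℕ) : ℝ) ≤ (m : ℝ) ^ (d + l) := by
    exact_mod_cast (Nat.choose_le_pow m d).trans (Nat.pow_le_pow_right (by omega) (by omega))
  have h3 : Real.exp (-q * (γ ^ 2 / 2)) ≤ Real.exp (-(c * (m - (d + l : ℕ)))) := by
    apply Real.exp_le_exp.2
    have h4 : ((m : ℝ) - (d + l : ℕ)) ≤ q * (d + l : ℕ) := by
      have : m ≤ q * (d + l) + (d + l) := hq2.trans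
        (Nat.add_le_add_right (Nat.mul_le_mul_left q (Nat.le_add_left l d)) _)
      have h5 : (m : ℝ) ≤ q * (d + l : ℕ) + (d + l : ℕ) := by exact_mod_cast this
      linarith
    have h6 : c * (d + l : ℕ) = γ ^ 2 / 2 := by
      rw [hcdef]
      exact div_mul_cancel₀ _ hk'.ne'
    nlinarith [mul_le_mul_of_nonneg_left h4 hc.le]
  have h4 : (m.choose d : ℝ) * Real.exp (-q * (γ ^ 2 / 2)) * (8 * (1 + 2 * m)) ≤ 1 := by
    refine le_trans ?_ (hN₂ m hm2)
    calc (m.choose d : ℝ) * Real.exp (-q * (γ ^ 2 / 2)) * (8 * (1 + 2 * m))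
        ≤ (m : ℝ) ^ (d + l) * Real.exp (-(c * (m - (d + l : ℕ)))) * (8 * (1 + 2 * m)) := by gcongr
      _ = _ := by ring
  have h5 : (m.choose d : ℝ) * Real.exp (-q * (γ ^ 2 / 2)) ≤ 1 / (8 * (1 + 2 * m)) := by
    rw [le_div_iff₀ (by positivity)]
    exact h4
  have h6 : (n : ℝ) ^ m = n ^ (m - 1) * n := by
    rw [← pow_succ]
    congr 1
    omega
  calc (m.choose d : ℝ) * m * ((n : ℝ) ^ (m - 1) * Real.exp (-q * (γ ^ 2 / 2)))
      = (m.choose d * Real.exp (-q * (γ ^ 2 / 2))) * (m * (n : ℝ) ^ (m - 1)) := by ring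
    _ ≤ 1 / (8 * (1 + 2 * m)) * (m * (n : ℝ) ^ (m - 1)) :=
      mul_le_mul_of_nonneg_right h5 (by positivity)
    _ = 1 / (4 * (1 + 2 * m)) * (m / n) * ((1 - 1 / 2) * (n : ℝ) ^ m) := by
      rw [h6]
      field_simp
      ring
    _ ≤ _ := mul_le_mul_of_nonneg_left h1 (by positivity)

end HypergraphSampling

/-! ### From spread bijections to spread embeddings -/

namespace Hypergraph

universe u v w

/-- Induction removing one factor: `(n + 1) ^ s ≤ 3 * n ^ s` for `s ≤ n`, because `(1 + 1 / n) ^ n ≤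
e < 3`. -/
theorem pow_le_three_pow_mul_descFactorial (s n : ℕ) (h : s ≤ n) :
    (n : ℝ) ^ s ≤ 3 ^ s * n.descFactorial s := by
  induction s generalizing n with
  | zero => simp
  | succ s ih =>
    obtain ⟨n, rfl⟩ : ∃ n', n = n' + 1 := ⟨n - 1, by omega⟩
    have hs : s ≤ n := by omega
    have h1 : ((n + 1 : ℕ) : ℝ) ^ s ≤ 3 * (n : ℝ) ^ s := by
      rcases Nat.eq_zero_or_pos n with rfl | hn
      · obtain rfl : s = 0 := by omega
        norm_num
      · have hn0 : (0 : ℝ) < n := by exact_mod_cast hn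
        have h2 : ((n + 1 : ℕ) : ℝ) = n * (1 + 1 / n) := by
          push_cast
          field_simp
        have h3 : (1 + 1 / n : ℝ) ^ s ≤ 3 := by
          calc (1 + 1 / n : ℝ) ^ s ≤ (1 + 1 / n : ℝ) ^ n :=
                pow_le_pow_right₀ (by simp) hs
            _ ≤ Real.exp (1 / n) ^ n := by
                gcongr
                rw [add_comm]
                exact Real.add_one_le_exp _
            _ = Real.exp 1 := by
                rw [← Real.exp_nat_mul, mul_one_div, div_self hn0.ne']
            _ ≤ 3 := by linarith [Real.exp_one_lt_d9]
        rw [h2, mul_pow, mul_comm]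
        exact mul_le_mul_of_nonneg_right h3 (by positivity)
    rw [Nat.succ_descFactorial_succ, pow_succ, pow_succ]
    push_cast at h1 ⊢
    have h4 := ih n hs
    have h5 : (0 : ℝ) ≤ (n : ℝ) + 1 := by positivity
    calc ((n : ℝ) + 1) ^ s * (n + 1) ≤ (3 * (3 ^ s * n.descFactorial s)) * (n + 1) := by
          refine mul_le_mul_of_nonneg_right (h1.trans ?_) h5
          linarith
      _ = _ := by ring

variable {V : Type u} {W : Type v}

open Finset in
open Classical in
/-- A spread random bijection that can be repaired block by block to embeddings yields a spread
random embedding. -/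
theorem hasVertexSpreadEmbedding_of_blocks {J : Type*} [DecidableEq J] (G : Hypergraph V)
    (H : Hypergraph W) [Fintype G.vertexSet] [Fintype H.vertexSet] (b : G.vertexSet → J) (n M : ℕ)
    (hG : Fintype.card G.vertexSet = n)
    (hM : ∀ j, Fintype.card {x // b x = j} ≤ M)
    (hedge : ∀ e ∈ G.edgeSet, ∃ j, ∀ x : G.vertexSet, (x : V) ∈ e → b x = j)
    (Q : Finset (G.vertexSet ≃ H.vertexSet)) (hQ : Q.Nonempty)
    (hblock : ∀ π ∈ Q, ∀ j, ∃ ψ : {x // b x = j} ↪ H.vertexSet,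
      (∀ x : {x // b x = j}, ∃ x', b x' = j ∧ ψ x = π x') ∧
      ∀ e ∈ G.edgeSet, (∀ x : G.vertexSet, (x : V) ∈ e → b x = j) →
        {w : W | ∃ x : {x // b x = j}, ((x : G.vertexSet) : V) ∈ e ∧ (ψ x : W) = w} ∈ H.edgeSet)
    (hspread : ∀ (s : ℕ) (x : Fin s ↪ G.vertexSet) (y : Fin s ↪ H.vertexSet),
      ((Q.filter fun π => ∀ i, π (x i) = y i).card : ℝ) * n.descFactorial s ≤ 2 ^ s * Q.card) :
    HasVertexSpreadEmbedding ((6 * M : ℝ) / n) G H := by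
  choose ψ hψ1 hψ2 using hblock
  have hinj : ∀ π (hπ : π ∈ Q), Function.Injective fun x => ψ π hπ (b x) ⟨x, rfl⟩ := by
    intro π hπ x x' h
    have hbb : b x = b x' := by
      obtain ⟨z, hz, hz'⟩ := hψ1 π hπ (b x) ⟨x, rfl⟩
      obtain ⟨w, hw, hw'⟩ := hψ1 π hπ (b x') ⟨x', rfl⟩
      have h' : ψ π hπ (b x) ⟨x, rfl⟩ = ψ π hπ (b x') ⟨x', rfl⟩ := h
      rw [hz', hw'] at h'
      rw [← hz, ← hw, π.injective h']
    have h2 : ∀ j (hj : b x' = j), ψ π hπ (b x') ⟨x', rfl⟩ = ψ π hπ j ⟨x', hj⟩ := by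
      rintro _ rfl
      rfl
    have h3 : ψ π hπ (b x) ⟨x, rfl⟩ = ψ π hπ (b x) ⟨x', hbb.symm⟩ := h.trans (h2 _ hbb.symm)
    exact congrArg Subtype.val ((ψ π hπ (b x)).injective h3)
  let φ : (G.vertexSet ≃ H.vertexSet) → (G.vertexSet ↪ H.vertexSet) := fun π =>
    if hπ : π ∈ Q then ⟨fun x => ψ π hπ (b x) ⟨x, rfl⟩, hinj π hπ⟩ else π.toEmbedding
  have hφ : ∀ π (hπ : π ∈ Q), ∀ x, φ π x = ψ π hπ (b x) ⟨x, rfl⟩ := by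
    intro π hπ x
    simp only [φ, dif_pos hπ]
    rfl
  refine ⟨(PMF.uniformOfFinset Q hQ).map φ, ?_, ?_⟩
  · intro f hf e he
    rw [PMF.mem_support_map_iff] at hf
    obtain ⟨π, hπ, rfl⟩ := hf
    rw [PMF.mem_support_uniformOfFinset_iff] at hπ
    obtain ⟨j, hj⟩ := hedge e he
    convert hψ2 π hπ j e he hj using 1
    ext w
    simp only [Set.mem_ofPred_eq]
    constructor
    · rintro ⟨x, hx, rfl⟩
      have hb := hj x hx
      subst hb
      exact ⟨⟨x, rfl⟩, hx, by rw [hφ π hπ]⟩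
    · rintro ⟨⟨x, hb⟩, hx, rfl⟩
      subst hb
      exact ⟨x, hx, by rw [hφ π hπ]⟩
  · intro s x y
    rw [PMF.toOuterMeasure_map_apply, PMF.toOuterMeasure_uniformOfFinset_apply]
    have hsn : s ≤ n := by
      have := Fintype.card_le_of_embedding x
      rwa [Fintype.card_fin, hG] at this
    have hdf : (0 : ℝ) < n.descFactorial s := by exact_mod_cast Nat.descFactorial_pos.2 hsn
    have hQ0 : (0 : ℝ) < Q.card := by exact_mod_cast hQ.card_pos
    -- The possible sequences of preimages of `y` under the bijection: the repair stays within
    -- blocks, so the `i`-th preimage lies in the block of `x i`, leaving at most `M ^ s` sequences.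
    let Ξ : Finset (Fin s → G.vertexSet) :=
      (Fintype.piFinset fun i => univ.filter fun x' => b x' = b (x i)).filter Function.Injective
    have hΞ : (Ξ.card : ℝ) ≤ (M : ℝ) ^ s := by
      have h1 : Ξ.card ≤ ∏ _i : Fin s, M := by
        refine (card_filter_le _ _).trans ?_
        rw [Fintype.card_piFinset]
        refine prod_le_prod' fun i _ => ?_
        rw [← Fintype.card_subtype]
        exact hM _
      simpa using (Nat.cast_le (α := ℝ)).2 h1
    have hsub : (Q.filter fun π => π ∈ φ ⁻¹' {f | ∀ i, f (x i) = y i}) ⊆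
        Ξ.biUnion fun ξ => Q.filter fun π => ∀ i, π (ξ i) = y i := by
      intro π hπ
      obtain ⟨hπQ, hπ⟩ := mem_filter.1 hπ
      have hπ' : ∀ i, φ π (x i) = y i := hπ
      refine mem_biUnion.2 ⟨fun i => π.symm (y i), ?_, mem_filter.2 ⟨hπQ, fun i => by simp⟩⟩
      refine mem_filter.2 ⟨Fintype.mem_piFinset.2 fun i => mem_filter.2 ⟨mem_univ _, ?_⟩,
        π.symm.injective.comp y.injective⟩
      obtain ⟨z, hz, hz'⟩ := hψ1 π hπQ (b (x i)) ⟨x i, rfl⟩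
      rw [← hz, ← hπ' i, hφ π hπQ, hz', Equiv.symm_apply_apply]
    have hcount : ((Q.filter fun π => π ∈ φ ⁻¹' {f | ∀ i, f (x i) = y i}).card : ℝ) *
        n.descFactorial s ≤ (M : ℝ) ^ s * (2 ^ s * Q.card) := by
      have h1 : ((Q.filter fun π => π ∈ φ ⁻¹' {f | ∀ i, f (x i) = y i}).card : ℝ) ≤
          ∑ ξ ∈ Ξ, ((Q.filter fun π => ∀ i, π (ξ i) = y i).card : ℝ) := by
        exact_mod_cast (card_le_card hsub).trans card_biUnion_le
      have h2 : ∀ ξ ∈ Ξ, ((Q.filter fun π => ∀ i, π (ξ i) = y i).card : ℝ) *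
          n.descFactorial s ≤ 2 ^ s * Q.card := fun ξ hξ =>
        hspread s ⟨ξ, (mem_filter.1 hξ).2⟩ y
      calc _ ≤ (∑ ξ ∈ Ξ, ((Q.filter fun π => ∀ i, π (ξ i) = y i).card : ℝ)) *
            n.descFactorial s := mul_le_mul_of_nonneg_right h1 hdf.le
        _ ≤ ∑ _ξ ∈ Ξ, (2 : ℝ) ^ s * Q.card := by
            rw [sum_mul]
            exact sum_le_sum h2
        _ = Ξ.card * (2 ^ s * Q.card) := by rw [sum_const, nsmul_eq_mul]
        _ ≤ _ := mul_le_mul_of_nonneg_right hΞ (by positivity)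
    have hreal : ((Q.filter fun π => π ∈ φ ⁻¹' {f | ∀ i, f (x i) = y i}).card : ℝ) / Q.card ≤
        ((6 * M : ℝ) / n) ^ s := by
      rw [div_le_iff₀ hQ0]
      refine le_of_mul_le_mul_right (hcount.trans ?_) hdf
      rcases Nat.eq_zero_or_pos s with rfl | hs
      · simp
      have hn0 : (0 : ℝ) < n := by exact_mod_cast (by omega : 0 < n)
      have h3 := pow_le_three_pow_mul_descFactorial s n hsn
      have h4 : (1 : ℝ) ≤ 3 ^ s * n.descFactorial s / (n : ℝ) ^ s := by
        rw [le_div_iff₀ (by positivity), one_mul]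
        exact h3
      calc (M : ℝ) ^ s * (2 ^ s * Q.card) = (M : ℝ) ^ s * (2 ^ s * Q.card) * 1 := by ring
        _ ≤ (M : ℝ) ^ s * (2 ^ s * Q.card) * (3 ^ s * n.descFactorial s / (n : ℝ) ^ s) :=
          mul_le_mul_of_nonneg_left h4 (by positivity)
        _ = _ := by
          rw [div_pow, mul_pow, show (6 : ℝ) = 2 * 3 by norm_num, mul_pow]
          ring
    rw [← ENNReal.ofReal_pow (by positivity)]
    rw [← ENNReal.ofReal_natCast, ← ENNReal.ofReal_natCast Q.card, ← ENNReal.ofReal_div_of_pos hQ0]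
    refine ENNReal.ofReal_le_ofReal ?_
    convert hreal

/-! ### Isomorphism invariance of copies and thresholds -/

theorem IsEmbedding.trans {U : Type w} {G : Hypergraph U} {H : Hypergraph V} {K : Hypergraph W}
    {φ : G.vertexSet ↪ H.vertexSet} {ψ : H.vertexSet ↪ K.vertexSet} (hφ : IsEmbedding G H φ)
    (hψ : IsEmbedding H K ψ) : IsEmbedding G K (φ.trans ψ) := by
  intro e he
  convert hψ _ (hφ e he) using 1
  ext w
  constructor
  · rintro ⟨x, hx, rfl⟩
    exact ⟨φ x, ⟨x, hx, rfl⟩, rfl⟩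
  · rintro ⟨y, ⟨x, hx, hxy⟩, rfl⟩
    refine ⟨x, hx, ?_⟩
    rw [← Subtype.ext hxy]
    rfl

theorem ContainsCopy.trans {U : Type w} {G : Hypergraph U} {H : Hypergraph V} {K : Hypergraph W}
    (h : ContainsCopy G H) (h' : ContainsCopy H K) : ContainsCopy G K := by
  obtain ⟨φ, hφ⟩ := h
  obtain ⟨ψ, hψ⟩ := h'
  exact ⟨_, hφ.trans hψ⟩

theorem ContainsCopy.copies {F : Hypergraph V} {F' : Hypergraph W} (h : ContainsCopy F F')
    (m : ℕ) : ContainsCopy (F.copies m) (F'.copies m) := by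
  obtain ⟨φ, hφ⟩ := h
  refine ⟨⟨fun p => ⟨(p.1.1, φ ⟨p.1.2, p.2.2⟩), p.2.1, (φ ⟨p.1.2, p.2.2⟩).2⟩, ?_⟩, ?_⟩
  · rintro ⟨⟨i, x⟩, hi, hx⟩ ⟨⟨j, y⟩, hj, hy⟩ h
    have h₀ := congrArg Subtype.val h
    obtain rfl : i = j := congrArg Prod.fst h₀
    have h' := φ.injective (Subtype.ext (congrArg Prod.snd h₀))
    obtain rfl : x = y := congrArg Subtype.val h'
    rfl
  · rintro _ ⟨i, hi, e, he, rfl⟩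
    refine ⟨i, hi, _, hφ e he, ?_⟩
    ext ⟨j, w⟩
    simp only [Set.mem_ofPred_eq, Set.mem_image]
    constructor
    · rintro ⟨⟨⟨a, x⟩, ha, hx⟩, ⟨z, hz, hzx⟩, h⟩
      simp only [Prod.mk.injEq] at hzx
      obtain ⟨rfl, rfl⟩ := hzx
      rw [← h]
      exact ⟨_, ⟨⟨z, hx⟩, hz, rfl⟩, rfl⟩
    · rintro ⟨_, ⟨x, hx, rfl⟩, h⟩
      refine ⟨⟨(i, x), hi, x.2⟩, ⟨x, hx, rfl⟩, ?_⟩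
      rw [← h]
      rfl

theorem HasOrder.unique {H : Hypergraph V} {m n : ℕ} (h : H.HasOrder m) (h' : H.HasOrder n) :
    m = n := by
  unfold HasOrder at h h'
  rw [h] at h'
  exact_mod_cast h'

theorem HasOrder.nonempty_equiv {H : Hypergraph V} {n : ℕ} (h : H.HasOrder n) :
    Nonempty (Fin n ≃ H.vertexSet) := by
  have hfin : H.vertexSet.Finite := Set.finite_of_encard_eq_coe h
  have := hfin.fintype
  refine ⟨(Fintype.equivFinOfCardEq ?_).symm⟩
  rw [← Set.toFinset_card, ← Nat.cast_inj (R := ℕ∞), ← Set.encard_coe_eq_coe_finsetCard,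
    Set.coe_toFinset]
  exact h

theorem copies_injective {F : Hypergraph V} {r : ℕ} (hr : 1 ≤ r) (hF : F.HasOrder r) :
    Function.Injective F.copies := by
  intro m m' h
  have h1 := hF.copies m
  rw [h] at h1
  exact Nat.eq_of_mul_eq_mul_right hr (h1.unique (hF.copies m'))

/-- For `r ≥ 1` distinct `m` give members of distinct order, so "all but finitely many members"
means "all large `m`". -/
theorem finite_factorFamily_iff {F : Hypergraph V} {r : ℕ} (hr : 1 ≤ r) (hF : F.HasOrder r)
    (P : Hypergraph (ℕ × V) → Prop) :
    {G ∈ F.factorFamily | ¬ P G}.Finite ↔ ∃ m₀, ∀ m ≥ m₀, P (F.copies m) := by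
  constructor
  · intro h
    have h1 := h.preimage ((copies_injective hr hF).injOn (s := F.copies ⁻¹' _))
    obtain ⟨b, hb⟩ := h1.bddAbove
    refine ⟨b + 1, fun m hm => ?_⟩
    by_contra hP
    have : m ≤ b := hb ⟨⟨m, rfl⟩, hP⟩
    omega
  · rintro ⟨m₀, h⟩
    refine ((Set.finite_Iio m₀).image F.copies).subset ?_
    rintro _ ⟨⟨m, rfl⟩, hm⟩
    refine ⟨m, ?_, rfl⟩
    by_contra hlt
    exact hm (h m (not_lt.1 hlt))

theorem diracAdmissible_factorFamily_iff {F : Hypergraph V} {r : ℕ} (hr : 1 ≤ r)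
    (hF : F.HasOrder r) (k d : ℕ) (δ : ℝ) :
    DiracAdmissible k d F.factorFamily δ ↔ ∀ α : ℝ, 0 < α → ∃ m₀, ∀ m ≥ m₀,
      ∀ (W : Type) (H : Hypergraph W), H.HasOrder (m * r) → H.IsKUniform k →
      (δ + α) * ((m * r - d).choose (k - d) : ℝ) ≤ (H.minDegree d : ℝ) →
      ContainsCopy (F.copies m) H := by
  refine forall₂_congr fun α _ => ?_
  rw [finite_factorFamily_iff hr hF]
  refine exists_congr fun m₀ => forall₂_congr fun m _ => ?_
  constructor
  · exact fun h W H => h (m * r) (hF.copies m) W H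
  · intro h n hn W H
    obtain rfl := (hF.copies m).unique hn
    exact h W H

theorem diracAdmissible_of_containsCopy {F : Hypergraph V} {F' : Hypergraph W} {r : ℕ}
    (hr : 1 ≤ r) (hF : F.HasOrder r) (hF' : F'.HasOrder r) (h : ContainsCopy F F') {k d : ℕ}
    {δ : ℝ} (hδ : DiracAdmissible k d F'.factorFamily δ) :
    DiracAdmissible k d F.factorFamily δ := by
  rw [diracAdmissible_factorFamily_iff hr hF]
  rw [diracAdmissible_factorFamily_iff hr hF'] at hδ
  intro α hα
  obtain ⟨m₀, hm₀⟩ := hδ α hα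
  exact ⟨m₀, fun m hm U H h1 h2 h3 => (h.copies m).trans (hm₀ m hm U H h1 h2 h3)⟩

/-- Allows `F` to be replaced by an isomorphic hypergraph on `Fin r`, which leaves finitely many
cases. -/
theorem factorThreshold_congr {F : Hypergraph V} {F' : Hypergraph W} {r : ℕ}
    (hr : 1 ≤ r) (hF : F.HasOrder r) (hF' : F'.HasOrder r) (h : ContainsCopy F F')
    (h' : ContainsCopy F' F) (k d : ℕ) : F.factorThreshold k d = F'.factorThreshold k d := by
  unfold factorThreshold diracThreshold
  congr 1
  ext δ
  exact and_congr_right fun _ => ⟨diracAdmissible_of_containsCopy hr hF' hF h',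
    diracAdmissible_of_containsCopy hr hF hF' h⟩

/-- The hypergraph on all of `U` whose edges are the preimages of the edges of `H`. -/
def pullback {U : Type w} (H : Hypergraph V) (ι : U ≃ H.vertexSet) : Hypergraph U where
  vertexSet := Set.univ
  edgeSet := {s | (fun i => (ι i : V)) '' s ∈ H.edgeSet}
  subset_vertexSet_of_mem_edgeSet' _ _ := Set.subset_univ _

section Pullback

variable {U : Type w} {H : Hypergraph V} (ι : U ≃ H.vertexSet)

theorem injective_coe_equiv : Function.Injective fun i => (ι i : V) :=
  Subtype.val_injective.comp ι.injective

theorem image_preimage_coe_equiv {s : Set V} (hs : s ⊆ H.vertexSet) :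
    (fun i => (ι i : V)) '' ((fun i => (ι i : V)) ⁻¹' s) = s := by
  rw [Set.image_preimage_eq_iff]
  intro x hx
  exact ⟨ι.symm ⟨x, hs hx⟩, by simp⟩

theorem HasOrder.pullback {n : ℕ} (h : H.HasOrder n) : (H.pullback ι).HasOrder n := by
  have h1 : (fun i => (ι i : V)) '' Set.univ = H.vertexSet := by
    ext x
    simp only [Set.image_univ, Set.mem_range]
    exact ⟨fun ⟨i, hi⟩ => hi ▸ (ι i).2, fun hx => ⟨ι.symm ⟨x, hx⟩, by simp⟩⟩
  unfold HasOrder at *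
  rw [← h, ← h1, (injective_coe_equiv ι).encard_image]
  rfl

theorem IsKUniform.pullback {k : ℕ} (h : H.IsKUniform k) : (H.pullback ι).IsKUniform k := by
  intro e he
  rw [← h _ he, (injective_coe_equiv ι).encard_image]

theorem containsCopy_pullback : ContainsCopy (H.pullback ι) H := by
  refine ⟨(Equiv.Set.univ U).toEmbedding.trans ι.toEmbedding, fun e he => ?_⟩
  have he' : (fun i => (ι i : V)) '' e ∈ H.edgeSet := he
  convert he' using 1
  ext w
  constructor
  · rintro ⟨x, hx, rfl⟩
    exact ⟨x, hx, rfl⟩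
  · rintro ⟨x, hx, rfl⟩
    exact ⟨⟨x, trivial⟩, hx, rfl⟩

theorem containsCopy_pullback' : ContainsCopy H (H.pullback ι) := by
  refine ⟨ι.symm.toEmbedding.trans (Equiv.Set.univ U).symm.toEmbedding, fun e he => ?_⟩
  change (fun i => (ι i : V)) '' _ ∈ H.edgeSet
  convert he using 1
  rw [← image_preimage_coe_equiv ι (H.subset_vertexSet_of_mem_edgeSet' he)]
  congr 1
  ext u
  constructor
  · rintro ⟨x, ⟨i, hi, hix⟩, rfl⟩
    have : x = ι i := Subtype.ext hix.symm
    subst this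
    change ((ι (ι.symm (ι i)) : H.vertexSet) : V) ∈ e
    rw [ι.symm_apply_apply]
    simpa using hi
  · intro hu
    refine ⟨ι u, ?_, ι.symm_apply_apply u⟩
    rw [image_preimage_coe_equiv ι (H.subset_vertexSet_of_mem_edgeSet' he)]
    exact hu

theorem setDegree_pullback (D : Set U) :
    (H.pullback ι).setDegree D = H.setDegree ((fun i => (ι i : V)) '' D) := by
  have hinj := injective_coe_equiv ι
  unfold setDegree
  rw [← Set.ncard_image_of_injective _ hinj.image_injective]
  congr 1
  ext e
  constructor
  · rintro ⟨s, ⟨hs, hD⟩, rfl⟩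
    exact ⟨hs, Set.image_mono hD⟩
  · rintro ⟨he, hD⟩
    have h1 := image_preimage_coe_equiv ι (H.subset_vertexSet_of_mem_edgeSet' he)
    refine ⟨_, ⟨?_, ?_⟩, h1⟩
    · change _ '' _ ∈ H.edgeSet
      rw [h1]
      exact he
    · exact Set.image_subset_iff.1 hD

theorem minDegree_pullback_ge {n d : ℕ} (h : H.HasOrder n) (hd : d ≤ n) :
    H.minDegree d ≤ (H.pullback ι).minDegree d := by
  have hne : {m | ∃ D ⊆ (H.pullback ι).vertexSet, D.encard = d ∧
      (H.pullback ι).setDegree D = m}.Nonempty := by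
    obtain ⟨D, hD, hDc⟩ := Set.exists_subset_encard_eq (s := (H.pullback ι).vertexSet) (k := d)
      (by rw [h.pullback ι]; exact_mod_cast hd)
    exact ⟨_, D, hD, hDc, rfl⟩
  obtain ⟨D, hD, hDc, hm⟩ := Nat.sInf_mem hne
  unfold minDegree
  rw [← hm, setDegree_pullback]
  refine Nat.sInf_le ⟨_, ?_, ?_, rfl⟩
  · rintro _ ⟨i, _, rfl⟩
    exact (ι i).2
  · rw [(injective_coe_equiv ι).encard_image, hDc]

end Pullback

/-- This finiteness makes the constants independent of `F`. -/
instance (U : Type w) [Finite U] : Finite (Hypergraph U) :=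
  Finite.of_injective (fun H : Hypergraph U => (H.vertexSet, H.edgeSet)) fun H H' h => by
    simp only [Prod.mk.injEq] at h
    exact Hypergraph.ext h.1 h.2

/-- Above the threshold, `F`-factors exist for all large `m`, uniformly over all `F` on `r`
vertices. -/
theorem exists_forall_containsCopy_copies (k r : ℕ) (hr : 1 ≤ r) {α : ℝ} (hα : 0 < α) :
    ∃ m₀ : ℕ, ∀ m ≥ m₀, ∀ d < k, ∀ (V : Type u) (F : Hypergraph V), F.HasOrder r →
      ∀ (W : Type v) (H : Hypergraph W), H.HasOrder (m * r) → H.IsKUniform k →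
      (F.factorThreshold k d + α) * ((m * r - d).choose (k - d) : ℝ) ≤ (H.minDegree d : ℝ) →
      ContainsCopy (F.copies m) H := by
  -- One bound per pair (hypergraph on `Fin r`, degree `d`); the maximum over the finitely many
  -- pairs serves all. Transporting `H` to `Fin (m * r)` also brings it into `Type`, where the
  -- threshold is defined.
  have key : ∀ p : Hypergraph (Fin r) × Fin k, ∃ m₀ : ℕ, p.1.HasOrder r → ∀ m ≥ m₀,
      ∀ (W : Type) (H : Hypergraph W), H.HasOrder (m * r) → H.IsKUniform k →
      (p.1.factorThreshold k p.2 + α) * ((m * r - p.2).choose (k - p.2) : ℝ) ≤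
        (H.minDegree p.2 : ℝ) → ContainsCopy (p.1.copies m) H := by
    intro p
    by_cases hp : p.1.HasOrder r
    · have h1 := (isLeast_factorThreshold hr hp p.2.2.le).1.2
      rw [diracAdmissible_factorFamily_iff hr hp] at h1
      obtain ⟨m₀, hm₀⟩ := h1 α hα
      exact ⟨m₀, fun _ => hm₀⟩
    · exact ⟨0, fun h => absurd h hp⟩
  choose f hf using key
  obtain ⟨b, hb⟩ := (Set.finite_range f).bddAbove
  refine ⟨max b k, fun m hm d hd V F hF W H hH hU hdeg => ?_⟩
  obtain ⟨e⟩ := hF.nonempty_equiv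
  obtain ⟨ι⟩ := hH.nonempty_equiv
  have hF₀ := hF.pullback e
  have hdm : d ≤ m * r := by
    have : k ≤ m := (le_max_right _ _).trans hm
    nlinarith
  rw [factorThreshold_congr hr hF hF₀ (containsCopy_pullback' e) (containsCopy_pullback e)] at hdeg
  have h1 := hf (F.pullback e, ⟨d, hd⟩) hF₀ m
    ((hb ⟨_, rfl⟩).trans ((le_max_left _ _).trans hm)) _ (H.pullback ι) (hH.pullback ι)
    (hU.pullback ι) (hdeg.trans (Nat.cast_le.2 (minDegree_pullback_ge ι hH hdm)))
  exact (((containsCopy_pullback' e).copies m).trans h1).trans (containsCopy_pullback ι)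

/-- An interval of length `t` splits into consecutive intervals of length between `K` and `2 * K`. -/
theorem exists_blocks (t K : ℕ) (hK : 1 ≤ K) (hKt : K ≤ t) :
    ∃ (N : ℕ) (c : ℕ → Fin N) (a sz : Fin N → ℕ), ∀ j, K ≤ sz j ∧ sz j ≤ 2 * K ∧
      a j + sz j ≤ t ∧ ∀ i < t, c i = j ↔ a j ≤ i ∧ i < a j + sz j := by
  have hN : 1 ≤ t / K := (Nat.one_le_div_iff (by omega)).2 hKt
  have h1 : t / K * K ≤ t := Nat.div_mul_le_self t K
  have h2 : t < t / K * K + K := Nat.lt_div_mul_add (by omega)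
  generalize t / K = N at hN h1 h2
  -- With `N = t / K`, the last interval absorbs the remainder, which is less than `K`.
  refine ⟨N, fun i => ⟨min (i / K) (N - 1), by omega⟩, fun j => j * K,
    fun j => if (j : ℕ) + 1 = N then t - j * K else K, fun j => ?_⟩
  obtain ⟨j, hj⟩ := j
  simp only [Fin.mk.injEq]
  split_ifs with hjN
  · subst hjN
    rw [Nat.add_mul, one_mul] at h1 h2
    refine ⟨by omega, by omega, by omega, fun i hi => ?_⟩
    have h3 : j ≤ i / K ↔ j * K ≤ i := Nat.le_div_iff_mul_le (by omega)
    omega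
  · have h4 : (j + 1) * K ≤ (N - 1) * K := Nat.mul_le_mul_right K (by omega)
    have h5 : (N - 1) * K ≤ N * K := Nat.mul_le_mul_right K (by omega)
    have h6 : (j + 1) * K = j * K + K := by ring
    refine ⟨le_rfl, by omega, by omega, fun i hi => ?_⟩
    have h3 : j ≤ i / K ↔ j * K ≤ i := Nat.le_div_iff_mul_le (by omega)
    have h7 : i / K < j + 1 ↔ i < (j + 1) * K := Nat.div_lt_iff_lt_mul (by omega)
    omega

/-- The copies with index in `[a, a + m)` form a union of `m` copies. -/
def blockEquiv (F : Hypergraph V) (t a m : ℕ) (p : (F.copies t).vertexSet → Prop)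
    (ham : a + m ≤ t) (hp : ∀ x, p x ↔ a ≤ (x : ℕ × V).1 ∧ (x : ℕ × V).1 < a + m) :
    {x : (F.copies t).vertexSet // p x} ≃ (F.copies m).vertexSet where
  toFun x := ⟨(x.1.1.1 - a, x.1.1.2), by have := (hp x.1).1 x.2; change _ < _; omega, x.1.2.2⟩
  invFun y := ⟨⟨(y.1.1 + a, y.1.2), by have := y.2.1; change _ < _; omega, y.2.2⟩,
    (hp _).2 (by have := y.2.1; change _ ≤ _ ∧ _ < _; constructor <;> simp only <;> omega)⟩
  left_inv x := by
    have := (hp x.1).1 x.2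
    apply Subtype.ext
    apply Subtype.ext
    exact Prod.ext (by simp only; omega) rfl
  right_inv y := by
    apply Subtype.ext
    exact Prod.ext (by simp) rfl

/-- The subhypergraph of `H` induced by `U`. -/
def inducedOn (H : Hypergraph W) (U : Finset H.vertexSet) : Hypergraph W where
  vertexSet := Subtype.val '' (U : Set H.vertexSet)
  edgeSet := {e ∈ H.edgeSet | e ⊆ Subtype.val '' (U : Set H.vertexSet)}
  subset_vertexSet_of_mem_edgeSet' _ he := he.2

open Classical in
/-- The edges of `H` as finite sets of vertices. -/
noncomputable def edgeFinset (H : Hypergraph W) [Fintype H.vertexSet] :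
    Finset (Finset H.vertexSet) :=
  Finset.univ.filter fun s => Subtype.val '' (s : Set H.vertexSet) ∈ H.edgeSet

theorem encard_val_image {X : Set W} (s : Finset X) :
    (Subtype.val '' (s : Set X)).encard = s.card := by
  rw [Subtype.val_injective.encard_image, Set.encard_coe_eq_coe_finsetCard]

theorem HasOrder.inducedOn {H : Hypergraph W} (U : Finset H.vertexSet) : (H.inducedOn U).HasOrder U.card :=
  encard_val_image U

theorem IsKUniform.inducedOn {H : Hypergraph W} {k : ℕ} (h : H.IsKUniform k) (U : Finset H.vertexSet) :
    (H.inducedOn U).IsKUniform k := fun e he => h e he.1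

section EdgeFinset

variable {H : Hypergraph W} [Fintype H.vertexSet]

theorem mem_edgeFinset {s : Finset H.vertexSet} :
    s ∈ H.edgeFinset ↔ Subtype.val '' (s : Set H.vertexSet) ∈ H.edgeSet := by
  simp [edgeFinset]

theorem card_of_mem_edgeFinset {k : ℕ} (hU : H.IsKUniform k) {s : Finset H.vertexSet}
    (hs : s ∈ H.edgeFinset) : s.card = k := by
  have h := hU _ (mem_edgeFinset.1 hs)
  rw [encard_val_image] at h
  exact_mod_cast h

theorem exists_finset_of_subset {e : Set W} (he : e ⊆ H.vertexSet) :
    ∃ s : Finset H.vertexSet, Subtype.val '' (s : Set H.vertexSet) = e := by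
  classical
  refine ⟨(Subtype.val ⁻¹' e).toFinset, ?_⟩
  rw [Set.coe_toFinset, Subtype.image_preimage_coe, Set.inter_eq_right.2 he]

theorem val_image_subset_iff {X : Set W} {s s' : Finset X} :
    Subtype.val '' (s : Set X) ⊆ Subtype.val '' (s' : Set X) ↔ s ⊆ s' := by
  rw [Set.image_subset_image_iff Subtype.val_injective, Finset.coe_subset]

open Classical in
theorem minDegree_le_card_filter {d : ℕ} (D : Finset H.vertexSet) (hD : D.card = d) :
    H.minDegree d ≤ (H.edgeFinset.filter fun e => D ⊆ e).card := by
  have h1 : H.minDegree d ≤ H.setDegree (Subtype.val '' (D : Set H.vertexSet)) :=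
    Nat.sInf_le ⟨_, by rintro _ ⟨x, _, rfl⟩; exact x.2, by rw [encard_val_image, hD], rfl⟩
  refine h1.trans ?_
  have h2 : {e ∈ H.edgeSet | Subtype.val '' (D : Set H.vertexSet) ⊆ e} ⊆
      (fun s : Finset H.vertexSet => Subtype.val '' (s : Set H.vertexSet)) ''
        ((H.edgeFinset.filter fun e => D ⊆ e : Finset _) : Set (Finset H.vertexSet)) := by
    rintro e ⟨he, hDe⟩
    obtain ⟨s, rfl⟩ := exists_finset_of_subset (H.subset_vertexSet_of_mem_edgeSet' he)
    exact ⟨s, by simp [mem_edgeFinset, he, val_image_subset_iff.1 hDe], rfl⟩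
  refine (Set.ncard_le_ncard h2 ((Finset.finite_toSet _).image _)).trans ?_
  refine (Set.ncard_image_le (Finset.finite_toSet _)).trans ?_
  rw [Set.ncard_coe_finset]

open HypergraphSampling in
theorem le_minDegree_inducedOn {d : ℕ} {c : ℝ} (U : Finset H.vertexSet) (hd : d ≤ U.card)
    (h : ¬ HasLowDegree H.edgeFinset d c U) : c ≤ (H.inducedOn U).minDegree d := by
  classical
  -- Some `d`-set exists in `U`, so the minimum is attained rather than being the default `sInf ∅ =
  -- 0`.
  have hne : {m | ∃ D ⊆ (H.inducedOn U).vertexSet, D.encard = d ∧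
      (H.inducedOn U).setDegree D = m}.Nonempty := by
    obtain ⟨D, hD, hDc⟩ := Set.exists_subset_encard_eq (s := (H.inducedOn U).vertexSet) (k := d)
      (by rw [HasOrder.inducedOn U]; exact_mod_cast hd)
    exact ⟨_, D, hD, hDc, rfl⟩
  obtain ⟨D, hD, hDc, hm⟩ := Nat.sInf_mem hne
  unfold minDegree
  rw [← hm]
  obtain ⟨D, rfl⟩ := exists_finset_of_subset (H := H) (hD.trans (by
    rintro _ ⟨x, _, rfl⟩
    exact x.2))
  rw [encard_val_image, Nat.cast_inj] at hDc
  have hDU : D ⊆ U := val_image_subset_iff.1 hD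
  have h1 : c ≤ (H.edgeFinset.filter fun e => D ⊆ e ∧ e ⊆ U).card := by
    by_contra hlt
    refine h ⟨D, hDU, hDc, lt_of_eq_of_lt ?_ (not_le.1 hlt)⟩
    congr
  refine h1.trans (Nat.cast_le.2 ?_)
  have hinj : Function.Injective
      fun s : Finset H.vertexSet => Subtype.val '' (s : Set H.vertexSet) :=
    Subtype.val_injective.image_injective.comp Finset.coe_injective
  rw [← Set.ncard_coe_finset, ← Set.ncard_image_of_injective _ hinj]
  refine Set.ncard_le_ncard ?_ ?_
  · rintro _ ⟨s, hs, rfl⟩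
    simp only [Finset.coe_filter, Set.mem_ofPred_eq, mem_edgeFinset] at hs
    exact ⟨⟨hs.1, val_image_subset_iff.2 hs.2.2⟩, val_image_subset_iff.2 hs.2.1⟩
  · exact ((U.finite_toSet.image Subtype.val).finite_subsets).subset fun e he => he.1.2

end EdgeFinset

/-! ### Assembly of the two parts of the theorem -/

open HypergraphSampling Finset in
/-- Above the threshold for `F`-factors there are spread distributions on `F`-factors, with
constants uniform in `F`. -/
theorem exists_hasVertexSpreadEmbedding (k r : ℕ) (hr : 1 ≤ r) {α : ℝ} (hα : 0 < α) :
    ∃ C : ℝ, 0 < C ∧ ∃ n₀ : ℕ, ∀ d < k, ∀ n ≥ n₀, r ∣ n →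
      ∀ (V : Type u) (F : Hypergraph V), F.HasOrder r → F.IsKUniform k →
      ∀ (W : Type v) (H : Hypergraph W), H.HasOrder n → H.IsKUniform k →
        (F.factorThreshold k d + α) * ((n - d).choose (k - d) : ℝ) ≤ (H.minDegree d : ℝ) →
        HasVertexSpreadEmbedding (C / n) (F.copies (n / r)) H := by
  classical
  obtain ⟨M₀, hM₀⟩ := exists_inherits_minDegree.{u, v} k hα
  obtain ⟨m₀, hm₀⟩ := exists_forall_containsCopy_copies.{u, v} k r hr (half_pos hα)
  choose! n₁ hn₁ using hM₀
  -- `M₀` makes sampling work on every block, `m₀` guarantees factors at excess `α / 2`, and `k + 1`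
  -- ensures `d`-sets fit. The block sizes take finitely many values up to `M`, so one lower bound
  -- on `n` suffices.
  set K := max (max M₀ m₀) (k + 1) with hK
  have hKM : M₀ ≤ K := (le_max_left _ _).trans (le_max_left _ _)
  have hKm : m₀ ≤ K := (le_max_right _ _).trans (le_max_left _ _)
  have hKk : k + 1 ≤ K := le_max_right _ _
  clear_value K
  set M := 2 * K * r with hM
  have hM1 : 1 ≤ M := by
    have : 1 * 1 ≤ 2 * K * r := Nat.mul_le_mul (by omega) hr
    omega
  have hMr : (0 : ℝ) < M := by exact_mod_cast hM1
  refine ⟨6 * M, by positivity, max ((range (M + 1)).sup n₁) (K * r), ?_⟩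
  intro d hd n hn hrn V F hF hFk W H hH hHk hdeg
  obtain ⟨t, rfl⟩ := hrn
  rw [mul_comm r t] at *
  rw [Nat.mul_div_cancel t (by omega)]
  have hKt : K ≤ t := Nat.le_of_mul_le_mul_right ((le_max_right _ _).trans hn) hr
  have hn' : ∀ m ≤ M, n₁ m ≤ t * r := fun m hm =>
    (le_sup (f := n₁) (mem_range.2 (by omega))).trans ((le_max_left _ _).trans hn)
  have hn0 : 0 < t * r := Nat.mul_pos (by omega) hr
  obtain ⟨N, c, a, sz, hblocks⟩ := exists_blocks t K (by omega) hKt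
  obtain ⟨eG⟩ := (hF.copies t).nonempty_equiv
  obtain ⟨eH⟩ := hH.nonempty_equiv
  let : Fintype (F.copies t).vertexSet := Fintype.ofEquiv _ eG
  let : Fintype H.vertexSet := Fintype.ofEquiv _ eH
  have hcG : Fintype.card (F.copies t).vertexSet = t * r := by
    rw [← Fintype.card_congr eG, Fintype.card_fin]
  have hcH : Fintype.card H.vertexSet = t * r := by
    rw [← Fintype.card_congr eH, Fintype.card_fin]
  let b : (F.copies t).vertexSet → Fin N := fun x => c x.1.1
  have hb : ∀ j x, b x = j ↔ a j ≤ (x : ℕ × V).1 ∧ (x : ℕ × V).1 < a j + sz j :=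
    fun j x => (hblocks j).2.2.2 _ x.2.1
  let be : ∀ j, {x // b x = j} ≃ (F.copies (sz j)).vertexSet := fun j =>
    blockEquiv F t (a j) (sz j) (fun x => b x = j) (hblocks j).2.2.1 (hb j)
  have hcard : ∀ j, Fintype.card {x // b x = j} = sz j * r := by
    intro j
    obtain ⟨e⟩ := (hF.copies (sz j)).nonempty_equiv
    rw [Fintype.card_congr ((be j).trans e.symm), Fintype.card_fin]
  have hszM : ∀ j, sz j * r ≤ M := fun j => Nat.mul_le_mul_right r (hblocks j).2.1
  have hszK : ∀ j, K ≤ sz j * r := fun j =>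
    (hblocks j).1.trans (Nat.le_mul_of_pos_right _ (by omega))
  set δ := F.factorThreshold k d with hδ
  obtain ⟨hδ0, hδ1⟩ := (isLeast_factorThreshold hr hF hd.le).1.1
  let Bad : Finset H.vertexSet → Prop := fun U =>
    HasLowDegree H.edgeFinset d ((δ + α / 2) * (U.card - d).choose (k - d)) U
  obtain ⟨Q, hQ, hgood, hspread⟩ := LocalLemma.exists_spread_bijections b
    (by
      intro j
      have h0 : 0 < Fintype.card {x // b x = j} := by
        have := hszK j
        rw [hcard]
        omega
      obtain ⟨x⟩ := Fintype.card_pos_iff.1 h0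
      exact ⟨x.1, x.2⟩)
    (t * r) M hcG hcH (fun j => (hcard j).trans_le (hszM j)) hM1 Bad (1 / (4 * (1 + M)))
    (by positivity) (le_of_eq (by field_simp)) (by
      intro j y
      have h1 := hn₁ (sz j * r) (hKM.trans (hszK j)) (t * r) (hn' _ (hszM j)) d hd δ hδ0 hδ1
        (hcard j) hcH H.edgeFinset (fun e he => card_of_mem_edgeFinset hHk he)
        (fun D hD => hdeg.trans (Nat.cast_le.2
          (by convert minDegree_le_card_filter D hD))) y
      have h2 : ∀ σ : {x // b x = j} ↪ H.vertexSet, Bad (univ.map σ) ↔ HasLowDegree H.edgeFinset d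
          ((δ + α / 2) * (sz j * r - d).choose (k - d)) (univ.map σ) := by
        intro σ
        simp only [Bad, card_map, card_univ, hcard]
      simp only [h2, hcard]
      refine le_trans (le_of_eq ?_) (h1.trans ?_)
      · congr
      gcongr
      -- Block sizes vary by at most a factor 2, which is why the sampling bound carries `1 + 2 *
      -- m`: it then implies the bound with `1 + M`.
      have h3 : (M : ℝ) ≤ 2 * (sz j * r : ℕ) := by
        have : M ≤ 2 * (sz j * r) := by
          rw [hM, mul_assoc]
          exact Nat.mul_le_mul_left 2 (Nat.mul_le_mul_right r (hblocks j).1)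
        exact_mod_cast this
      exact h3)
  refine hasVertexSpreadEmbedding_of_blocks (F.copies t) H b (t * r) M hcG
    (fun j => (hcard j).trans_le (hszM j)) ?_ Q hQ ?_
    fun s x y => by convert hspread s x y
  · rintro _ ⟨i, hi, e, he, rfl⟩
    refine ⟨c i, ?_⟩
    rintro x ⟨v, hv, hvx⟩
    change c x.1.1 = c i
    rw [← hvx]
  · intro π hπ j
    set U := (univ.filter fun x => b x = j).map π.toEmbedding with hU
    have hUc : U.card = sz j * r := by
      rw [hU, card_map, ← Fintype.card_subtype, hcard]
    have hlow := le_minDegree_inducedOn (d := d) U (by have := hszK j; omega) (hgood π hπ j)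
    rw [hUc] at hlow
    obtain ⟨φ, hφ⟩ := hm₀ (sz j) (hKm.trans (hblocks j).1) d hd V F hF W (H.inducedOn U)
      (hUc ▸ HasOrder.inducedOn U) (hHk.inducedOn U) hlow
    have hsub : (H.inducedOn U).vertexSet ⊆ H.vertexSet := by
      rintro _ ⟨x, _, rfl⟩
      exact x.2
    refine ⟨(be j).toEmbedding.trans (φ.trans (Set.embeddingOfSubset _ _ hsub)),
      fun x => ?_, ?_⟩
    · obtain ⟨z, hz, hzx⟩ := (φ (be j x)).2
      obtain ⟨x', hx', rfl⟩ := mem_map.1 (mem_coe.1 hz)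
      exact ⟨x', (mem_filter.1 hx').2, Subtype.ext hzx.symm⟩
    · rintro _ ⟨i, hi, e, he, rfl⟩ hj
      -- A vertex of the edge is needed to conclude that its copy index `i` belongs to block `j`;
      -- for an empty edge the block condition would be vacuous.
      have hne : e.Nonempty := by
        rw [← Set.encard_pos, hFk e he]
        exact_mod_cast (by omega : 0 < k)
      obtain ⟨v, hv⟩ := hne
      have hvF := F.subset_vertexSet_of_mem_edgeSet' he
      have hij := (hb j ⟨(i, v), hi, hvF hv⟩).1 (hj _ ⟨v, hv, rfl⟩)
      simp only at hij
      have hedge := (hφ (Prod.mk (i - a j) '' e) ⟨i - a j, by omega, e, he, rfl⟩).1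
      convert hedge using 1
      ext w
      constructor
      · rintro ⟨x, ⟨z, hz, hzx⟩, rfl⟩
        refine ⟨be j x, ⟨z, hz, ?_⟩, rfl⟩
        change _ = (x.1.1.1 - a j, x.1.1.2)
        rw [← hzx]
      · rintro ⟨y, ⟨z, hz, hzy⟩, rfl⟩
        refine ⟨(be j).symm y, ⟨z, hz, ?_⟩, ?_⟩
        · change _ = (y.1.1 + a j, y.1.2)
          rw [← hzy]
          simp only [Prod.mk.injEq, and_true]
          omega
        · change ((φ (be j ((be j).symm y)) : (H.inducedOn U).vertexSet) : W) = _
          rw [Equiv.apply_symm_apply]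

/-- The first part makes the factor threshold admissible for spread. Conversely, any embedding in
the support of a spread distribution is a copy. -/
theorem vsdThreshold_eq_factorThreshold {k r d : ℕ} (hr : 1 ≤ r) (hd : d < k)
    {F : Hypergraph V} (hF : F.HasOrder r) (hFk : F.IsKUniform k) :
    vsdThreshold k d F.factorFamily = F.factorThreshold k d := by
  have h1 := isLeast_factorThreshold hr hF hd.le
  have h2 := isLeast_vsdThreshold hr hF hd.le
  refine le_antisymm (h2.2 ⟨h1.1.1, fun α hα => ?_⟩) (h1.2 ⟨h2.1.1, fun α hα => ?_⟩)
  · obtain ⟨C, hC, n₀, h⟩ := exists_hasVertexSpreadEmbedding.{_, 0} k r hr hα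
    refine ⟨C, hC, (finite_factorFamily_iff hr hF _).2 ⟨n₀, fun m hm n hn W H hH hHk hdeg => ?_⟩⟩
    obtain rfl := (hF.copies m).unique hn
    have h3 := h d hd (m * r) (hm.trans (Nat.le_mul_of_pos_right m hr)) (Dvd.intro_left m rfl)
      _ F hF hFk W H hH hHk hdeg
    rwa [Nat.mul_div_cancel m hr] at h3
  · obtain ⟨C, -, hfin⟩ := h2.1.2 α hα
    refine hfin.subset ?_
    rintro G ⟨hG, hn⟩
    refine ⟨hG, fun h => hn fun n hGn W H hH hHk hdeg => ?_⟩
    obtain ⟨μ, hμ, -⟩ := h n hGn W H hH hHk hdeg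
    obtain ⟨φ, hφ⟩ := μ.support_nonempty
    exact ⟨φ, hμ φ hφ⟩

end Hypergraph

theorem mainTheorem2 (k r : ℕ) (hr : 1 ≤ r) :
    (∀ α : ℝ, 0 < α → ∃ C : ℝ, 0 < C ∧ ∃ n₀ : ℕ,
      ∀ d : ℕ, 1 ≤ d → d < k → ∀ n : ℕ, n₀ ≤ n → r ∣ n →
      ∀ (V : Type*) (F : Hypergraph V), F.HasOrder r → F.IsKUniform k →
      ∀ (W : Type*) (H : Hypergraph W), H.HasOrder n → H.IsKUniform k →
        (F.factorThreshold k d + α) * ((n - d).choose (k - d) : ℝ) ≤ (H.minDegree d : ℝ) →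
        Hypergraph.HasVertexSpreadEmbedding (C / n) (F.copies (n / r)) H) ∧
    (∀ d : ℕ, 1 ≤ d → d < k →
      ∀ (V : Type*) (F : Hypergraph V), F.HasOrder r → F.IsKUniform k →
        Hypergraph.vsdThreshold k d F.factorFamily = F.factorThreshold k d) := by
  refine ⟨fun α hα => ?_, fun d _ hd V F hF hFk =>
    Hypergraph.vsdThreshold_eq_factorThreshold hr hd hF hFk⟩
  obtain ⟨C, hC, n₀, h⟩ := Hypergraph.exists_hasVertexSpreadEmbedding k r hr hα
  exact ⟨C, hC, n₀, fun d _ hd n hn => h d hd n hn⟩
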